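/- A two-stage stochastic optimization problem over a finite linearly ordered set $E=(e_1,\dots,e_n)$ asks to minimize $\mathbb{E}_{\xi|x}[f(\xi)]$ over $x\in\{0,1\}^E$ with $Cx\le d$, where the scenario $\xi\subseteq E$ is random with a distribution depending on $x$, and $f$ is a real-valued recourse function. It is *aggregable* if $f$ does not depend on $x$, if $\xi_1\subseteq\xi_2$ implies $f(\xi_1)\ge f(\xi_2)$, and if for every $x$ the events $\{e\in\xi\}$, $e\in E$, are independent. Let $\mathcal{C}(f)=\{f(\xi):\xi\subseteq E\}=\{\alpha_0<\dots<\alpha_N\}$ be the set of critical values, and for $\alpha\in\mathcal{C}(f)$ let $\mathcal{TM}_\alpha(f)=\{S\subseteq E: f(E\setminus S)>\alpha\}$. Let $B^{\le}_\alpha(f)$ be the reduced ordered binary decision diagram (BDD), for the given order of $E$, of the Boolean function that is $1$ at $\xi$ if and only if $f(\xi)\le\alpha$. It is unique up to isomorphism. Instances are presented by an input of some size $\sigma$. A class of aggregable problems is *polynomially aggregable* if $|\mathcal{C}(f)|$ is bounded by a polynomial in $\sigma$ and there is an algorithm that, given the input of any instance of the class, constructs all the BDDs $B^{\le}_{\alpha_0}(f),\dots,B^{\le}_{\alpha_N}(f)$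 in time polynomial in $\sigma$. **Lemma.** Consider a class of aggregable two-stage stochastic optimization problems such that 1. the number of critical values $|\mathcal{C}(f)|$ is bounded by a polynomial in the input size $\sigma$; 2. the sets $\mathcal{TM}_\alpha(f)$ are given explicitly: the input contains the set $E$, for every $\alpha\in\mathcal{C}(f)$, in increasing order of $\alpha$, the rows of a $0/1$ matrix $A_\alpha$ with columns $e_1,\dots,e_n$, and possibly further data. The rows of $A_\alpha$ are incidence vectors of members of $\mathcal{TM}_\alpha(f)$, and all inclusion-minimal members of $\mathcal{TM}_\alpha(f)$ occur among them (for example, the rows may be all members, or exactly the minimal ones); 3. there is a function $k$ with $k(\sigma)\in O(\log\sigma)$ such that, for every instance of size $\sigma$ and every $\alpha\in\mathcal{C}(f)$, the matrix $A_\alpha$ has bandwidth at most $k(\sigma)$, that is, the nonzero entries of each row lie within $k(\sigma)$ consecutive columns. Then the class is polynomially aggregable. -/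

import Mathlib

namespace ScenarioAgg

/-! ## Two-stage stochastic problems and their recourse functions -/

/-- The two-stage stochastic optimization problem
`min 𝔼_{ξ|x}[f(ξ)]` subject to `C x ≤ d`, `x ∈ {0,1}^E`, where `E = (e_1, …, e_n)` is a finite
linearly ordered set (here `Fin n`), scenarios are subsets of `E`, and `scenario x` is the
distribution of the random scenario given the first-stage decision `x`. -/
structure TwoStageProblem where
  n : ℕ
  m : ℕ
  C : Matrix (Fin m) (Fin n) ℝ
  d : Fin m → ℝ
  recourse : (Fin n → Bool) → Finset (Fin n) → ℝ
  scenario : (Fin n → Bool) → PMF (Finset (Fin n))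

namespace TwoStageProblem

/-- The set of admissible first-stage decisions. -/
def feasible (P : TwoStageProblem) : Set (Fin P.n → Bool) :=
  {x | P.C.mulVec (fun e => if x e then 1 else 0) ≤ P.d}

/-- The objective `𝔼_{ξ|x}[f(ξ)]`, to be minimized over `P.feasible`. -/
noncomputable def objective (P : TwoStageProblem) (x : Fin P.n → Bool) : ℝ :=
  ∑ ξ : Finset (Fin P.n), (P.scenario x ξ).toReal * P.recourse x ξ

/-- Aggregable: the recourse function does not depend on the first-stage decision, it is
counter-monotone with respect to inclusion of scenarios, and the elementary events `e ∈ ξ`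
are independent (under the scenario distribution belonging to any decision). -/
def Aggregable (P : TwoStageProblem) : Prop :=
  (∀ x x' ξ, P.recourse x ξ = P.recourse x' ξ) ∧
  (∀ x ξ₁ ξ₂, ξ₁ ⊆ ξ₂ → P.recourse x ξ₂ ≤ P.recourse x ξ₁) ∧
  ∀ x, letI : MeasurableSpace (Finset (Fin P.n)) := ⊤
    ProbabilityTheory.iIndepSet (fun e : Fin P.n => {ξ : Finset (Fin P.n) | e ∈ ξ})
      (P.scenario x).toMeasure

/-- The recourse function `f : 2^E → ℝ`; for an aggregable problem the decision at which
`recourse` is evaluated does not matter. -/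
def f (P : TwoStageProblem) (ξ : Finset (Fin P.n)) : ℝ := P.recourse (fun _ => false) ξ

end TwoStageProblem

/-- The set `𝒞(f)` of critical values of `f`. -/
noncomputable def critical {n : ℕ} (f : Finset (Fin n) → ℝ) : Finset ℝ :=
  Finset.univ.image f

/-- The critical values as an increasing list `α_0 < ⋯ < α_N`. -/
noncomputable def criticalList {n : ℕ} (f : Finset (Fin n) → ℝ) : List ℝ :=
  (critical f).sort (· ≤ ·)

/-- `𝒯ℳ_α(f)`: the failure sets whose complementary scenario has value strictly above `α`. -/
def TM {n : ℕ} (f : Finset (Fin n) → ℝ) (α : ℝ) : Set (Finset (Fin n)) :=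
  {S | α < f Sᶜ}

/-- The list `R` of sets gives `𝒯ℳ_α(f)` explicitly: it consists of members of `𝒯ℳ_α(f)` and
contains all inclusion-minimal ones. Both the list of all members and the list of the members
of the clutter of minimal members have this property. -/
def Lists {n : ℕ} (f : Finset (Fin n) → ℝ) (α : ℝ) (R : List (Finset (Fin n))) : Prop :=
  (∀ S ∈ R, S ∈ TM f α) ∧ ∀ S, Minimal (fun T => T ∈ TM f α) S → S ∈ R

/-- The incidence matrix of a list of sets: rows are the sets, columns the elements. -/
def incidence {n : ℕ} (R : List (Finset (Fin n))) : Matrix (Fin R.length) (Fin n) ℕ :=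
  Matrix.of fun i e => if e ∈ R.get i then 1 else 0

/-- Bandwidth at most `k`: in every row the nonzero entries lie in `k` consecutive columns. -/
def BandwidthLE {m n : ℕ} (A : Matrix (Fin m) (Fin n) ℕ) (k : ℕ) : Prop :=
  ∀ i j j', A i j ≠ 0 → A i j' ≠ 0 → (j' : ℕ) < (j : ℕ) + k

/-! ## Binary decision diagrams -/

/-- Nodes of a diagram with `s` inner nodes. -/
inductive Node (s : ℕ) where
  | bot : Node s
  | top : Node s
  | inner (i : Fin s) : Node s

/-- The underlying labelled digraph of a decision diagram over `e_1, …, e_n`: inner node `i`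
has layer `layer i` and the two outgoing arcs `i → child i b` with label `b`. -/
structure Diagram (n : ℕ) where
  s : ℕ
  layer : Fin s → Fin n
  child : Fin s → Bool → Node s
  root : Node s

namespace Diagram

variable {n : ℕ}

/-- There is an arc with label `b` from `u` to `v`. -/
def Arc (B : Diagram n) (b : Bool) (u v : Node B.s) : Prop :=
  ∃ i, u = Node.inner i ∧ B.child i b = v

/-- There is a directed path (possibly of length zero) from `u` to `v`. -/
def Reach (B : Diagram n) : Node B.s → Node B.s → Prop :=
  Relation.ReflTransGen fun u v => ∃ b, B.Arc b u v

/-- The node labels: the truth value of a leaf, the layer of an inner node. -/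
def label (B : Diagram n) : Node B.s → Bool ⊕ Fin n
  | .bot => .inl false
  | .top => .inl true
  | .inner i => .inr (B.layer i)

/-- The sub-diagrams rooted at `u` and `v` are isomorphic as digraphs with node and arc
labels. -/
def SubIso (B : Diagram n) (u v : Node B.s) : Prop :=
  ∃ φ : {w // B.Reach u w} ≃ {w // B.Reach v w},
    (∀ w, B.label (φ w).1 = B.label w.1) ∧
    ∀ b w w', B.Arc b w.1 w'.1 ↔ B.Arc b (φ w).1 (φ w').1

/-- The diagram is a (reduced, ordered) binary decision diagram. If the root is a leaf, the
condition on reachability leaves no inner node: these are the two degenerate diagrams. -/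
structure IsBDD (B : Diagram n) : Prop where
  /-- Arcs between inner nodes lead to strictly higher layers. -/
  ordered : ∀ i j b, B.child i b = Node.inner j → B.layer i < B.layer j
  /-- The two children of an inner node are distinct. -/
  distinct : ∀ i, B.child i false ≠ B.child i true
  /-- The root is the only source: every inner node is reachable from it. -/
  rooted : ∀ i, B.Reach B.root (Node.inner i)
  /-- Distinct nodes root non-isomorphic sub-diagrams. -/
  reduced : ∀ u v, B.SubIso u v → u = v

/-- The Boolean function of the diagram: `B.Sat ξ` says that some path from the root to `⊤`
uses only arcs `(u, v)` whose label is the truth value of `e_{ε(u)} ∈ ξ`. -/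
def Sat (B : Diagram n) (ξ : Finset (Fin n)) : Prop :=
  Relation.ReflTransGen
    (fun u v => ∃ i, u = Node.inner i ∧ B.child i (decide (B.layer i ∈ ξ)) = v)
    B.root Node.top

/-- `B` is the BDD `B^≤_α(f)`, i.e. the (up to isomorphism unique) BDD of the Boolean function
`Φ^≤_α` with `Φ^≤_α(ξ) = 1` if and only if `f(ξ) ≤ α`. -/
def IsLevelBDD (B : Diagram n) (f : Finset (Fin n) → ℝ) (α : ℝ) : Prop :=
  B.IsBDD ∧ ∀ ξ, B.Sat ξ ↔ f ξ ≤ α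

end Diagram

/-! ## Machine model

Programs compute on binary trees. They are built from the basic tree operations, composition,
a conditional and unbounded `while` loops; every operation is charged the size of the tree that
it is applied to. The size of each result is thus bounded by the cost of computing it, and up to
polynomial overhead this is the cost model of Turing machines. -/

/-- Binary trees. -/
inductive Data where
  | leaf : Data
  | node (l r : Data) : Data

/-- The number of vertices of a tree. -/
def Data.size : Data → ℕ
  | .leaf => 1
  | .node l r => l.size + r.size + 1

/-- Programs. -/
inductive Prog where
  /-- The identity. -/
  | skip : Prog
  /-- The constant `leaf`. -/
  | nil : Prog
  /-- The left subtree. -/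
  | hd : Prog
  /-- The right subtree. -/
  | tl : Prog
  /-- Test whether the left and the right subtree are equal. -/
  | eq : Prog
  /-- `x ↦ node (p x) (q x)` -/
  | pair (p q : Prog) : Prog
  /-- First `p`, then `q`. -/
  | seq (p q : Prog) : Prog
  /-- If the value of `c` is not `leaf`, then `p`, else `q`. -/
  | cond (c p q : Prog) : Prog
  /-- While the value of `c` is not `leaf`, apply `p`. -/
  | loop (c p : Prog) : Prog

/-- `Eval p x t y`: the program `p`, started on `x`, halts with result `y` at cost `t`. -/
inductive Eval : Prog → Data → ℕ → Data → Prop where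
  | skip (x) : Eval .skip x x.size x
  | nil (x) : Eval .nil x x.size .leaf
  | hd_leaf : Eval .hd .leaf Data.leaf.size .leaf
  | hd_node (a b) : Eval .hd (.node a b) (Data.node a b).size a
  | tl_leaf : Eval .tl .leaf Data.leaf.size .leaf
  | tl_node (a b) : Eval .tl (.node a b) (Data.node a b).size b
  | eq_leaf : Eval .eq .leaf Data.leaf.size .leaf
  | eq_true (a) : Eval .eq (.node a a) (Data.node a a).size (.node .leaf .leaf)
  | eq_false (a b) : a ≠ b → Eval .eq (.node a b) (Data.node a b).size .leaf
  | pair {p q x s t a b} : Eval p x s a → Eval q x t b →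
      Eval (.pair p q) x (x.size + s + t) (.node a b)
  | seq {p q x s t y z} : Eval p x s y → Eval q y t z →
      Eval (.seq p q) x (x.size + s + t) z
  | cond_true {c p q x s t a b y} : Eval c x s (.node a b) → Eval p x t y →
      Eval (.cond c p q) x (x.size + s + t) y
  | cond_false {c p q x s t y} : Eval c x s .leaf → Eval q x t y →
      Eval (.cond c p q) x (x.size + s + t) y
  | loop_done {c p x s} : Eval c x s .leaf →
      Eval (.loop c p) x (x.size + s) x
  | loop_step {c p x s t r a b y z} : Eval c x s (.node a b) → Eval p x t y →
      Eval (.loop c p) y r z → Eval (.loop c p) x (x.size + s + t + r) z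

/-! ## Encodings

Numbers are written in unary; they only occur as the cardinality of the explicitly given
ground set, as positions in it, and as positions in explicitly given lists. -/

def encList : List Data → Data
  | [] => .leaf
  | a :: l => .node a (encList l)

def encNat (j : ℕ) : Data := encList (List.replicate j .leaf)

def encBool : Bool → Data
  | false => .leaf
  | true => .node .leaf .leaf

/-- A set is written as its incidence vector. -/
def encSet {n : ℕ} (S : Finset (Fin n)) : Data :=
  encList (List.ofFn fun e => encBool (decide (e ∈ S)))

def encNode {s : ℕ} : Node s → Data
  | .bot => .leaf
  | .top => .node .leaf .leaf
  | .inner i => .node (.node .leaf .leaf) (encNat i)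

/-- A diagram is written as its root followed by the list of the layers and children (for label
`0` and for label `1`) of its inner nodes. -/
def encDiagram {n : ℕ} (B : Diagram n) : Data :=
  .node (encNode B.root) (encList (List.ofFn fun i =>
    .node (encNat (B.layer i)) (.node (encNode (B.child i false)) (encNode (B.child i true)))))

/-! ## Problem classes -/

/-- An instance: a two-stage problem together with the input by which it is presented. -/
structure Instance extends TwoStageProblem where
  input : Data

/-- The input size `σ`. -/
def Instance.inputSize (I : Instance) : ℕ := I.input.size

/-- The input consists of the ground set, for each critical value `α_0 < ⋯ < α_N` in this order
the incidence vectors of the sets in the list `table_j` giving `𝒯ℳ_{α_j}(f)` explicitly,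
and arbitrary further data. -/
def Instance.ExplicitTM (I : Instance) (table : List (List (Finset (Fin I.n)))) : Prop :=
  List.Forall₂ (Lists I.f) (criticalList I.f) table ∧
  ∃ further : Data, I.input = .node further
    (.node (encNat I.n) (encList (table.map fun R => encList (R.map encSet))))

/-- The number of critical values is polynomial in the input size. -/
def PolynomiallyManyCriticalValues (K : Set Instance) : Prop :=
  ∃ p : Polynomial ℕ, ∀ I ∈ K, (critical I.f).card ≤ p.eval I.inputSize

/-- All BDDs `B^≤_α(f)`, `α ∈ 𝒞(f)`, can be constructed in polynomial time: one program
computes from the input, at a cost polynomial in its size, the list of the BDDs for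
`α_0 < ⋯ < α_N`. -/
def BDDsInPolynomialTime (K : Set Instance) : Prop :=
  ∃ (prog : Prog) (q : Polynomial ℕ), ∀ I ∈ K, ∃ (L : List (Diagram I.n)) (t : ℕ),
    Eval prog I.input t (encList (L.map encDiagram)) ∧ t ≤ q.eval I.inputSize ∧
    List.Forall₂ (fun α B => B.IsLevelBDD I.f α) (criticalList I.f) L

/-- A polynomially aggregable class of two-stage stochastic optimization problems. -/
def PolynomiallyAggregable (K : Set Instance) : Prop :=
  (∀ I ∈ K, I.Aggregable) ∧ PolynomiallyManyCriticalValues K ∧ BDDsInPolynomialTime K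

end ScenarioAgg

namespace ScenarioAgg

/-! ## Functions computable in polynomial time -/

/-! Since `f` is antitone, `f ξ ≤ α` holds exactly when `ξ` meets every listed member of `TM f α`
(`stateSat_incidenceRows_iff`). The level function is thus a monotone conjunction of clauses, the
rows of the incidence matrix.

Fix the variables in order. After `i` of them, the residual function is described by a state: the
rows not yet hit, with their first `i` columns removed. A row that has no ones left and was never
hit makes the state unsatisfiable. In a nontrivial state, therefore, every unhit row has a one in a
later column, and by the bandwidth its ones among the decided columns lie in the last `k` of them.
Hence a nontrivial state depends only on the last `k` values (`run_eq_run`), each level has at most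
`2 ^ k` states (`length_level_le`), and this is polynomial in the input size because `k` is
logarithmic (`exists_polynomial_two_pow_le`).

Different states may still represent the same function, so the diagram of states need not be
reduced. The nodes are therefore created from the last level upwards with a table of existing nodes:
a state whose two children coincide takes over that child, and a state whose layer and children
already occur shares the existing node. `TablesCorrect` is the invariant of this process. In an
ordered diagram, uniqueness of layer and children already excludes isomorphic sub-diagrams
(`Diagram.eq_of_subIso`), so the result is the reduced diagram.

For the running time, `PolyTime` is closed under composition, branching and folds whose intermediate
results have polynomial size. States never grow and the tables grow by at most one entry per state,
so the width of the levels is the only quantity that needs the bandwidth. -/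

theorem Data.one_le_size (x : Data) : 1 ≤ x.size := by
  cases x <;> simp [Data.size]

/-- Every operation is charged at least the size of its result, so each time bound is also an output
size bound. This makes polynomial bounds compose. -/
theorem Eval.size_le {p : Prog} {x : Data} {t : ℕ} {y : Data} (h : Eval p x t y) :
    y.size ≤ t := by
  induction h with
  | skip x => exact le_rfl
  | nil x => exact x.one_le_size
  | hd_leaf => exact le_rfl
  | hd_node a b => simp only [Data.size]; omega
  | tl_leaf => exact le_rfl
  | tl_node a b => simp only [Data.size]; omega
  | eq_leaf => exact le_rfl
  | eq_true a => have := a.one_le_size; simp only [Data.size]; omega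
  | eq_false a b _ => have := a.one_le_size; simp only [Data.size]; omega
  | @pair _ _ x _ _ _ _ _ _ _ _ => have := x.one_le_size; simp only [Data.size]; omega
  | seq => omega
  | cond_true => omega
  | cond_false => omega
  | loop_done => omega
  | loop_step => omega

theorem polynomial_eval_mono (q : Polynomial ℕ) {a b : ℕ} (h : a ≤ b) :
    q.eval a ≤ q.eval b := by
  induction q using Polynomial.induction_on' with
  | add p q hp hq => simp only [Polynomial.eval_add]; omega
  | monomial n c =>
    simp only [Polynomial.eval_monomial]
    exact Nat.mul_le_mul_left _ (Nat.pow_le_pow_left h n)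

/-- Types whose elements are represented by binary trees. -/
class Enc (α : Type) where
  enc : α → Data

open Enc (enc)

instance : Enc Data := ⟨id⟩
instance : Enc Unit := ⟨fun _ => .leaf⟩
instance : Enc Bool := ⟨encBool⟩
instance : Enc ℕ := ⟨encNat⟩
instance {α β : Type} [Enc α] [Enc β] : Enc (α × β) := ⟨fun p => .node (enc p.1) (enc p.2)⟩
instance {α : Type} [Enc α] : Enc (List α) := ⟨fun l => encList (l.map enc)⟩
-- The proof leaves no trace in the representation, so `PolyTime` on a subtype expresses a promise
-- on the arguments.
instance {α : Type} [Enc α] (P : α → Prop) : Enc {a // P a} := ⟨fun a => enc a.1⟩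

/-- Types whose elements are represented faithfully. -/
class FaithfulEnc (α : Type) [Enc α] : Prop where
  inj : Function.Injective (enc : α → Data)

/-! ### Sizes and injectivity of the encodings -/

section Enc

variable {α β : Type} [Enc α] [Enc β]

theorem enc_prod (a : α) (b : β) : enc (a, b) = .node (enc a) (enc b) := rfl
theorem enc_nil : enc ([] : List α) = .leaf := rfl
theorem enc_cons (a : α) (l : List α) : enc (a :: l) = .node (enc a) (enc l) := rfl
theorem enc_true : enc true = .node .leaf .leaf := rfl
theorem enc_false : enc false = .leaf := rfl
theorem enc_subtype {P : α → Prop} (a : {a // P a}) : enc a = enc a.1 := rfl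
theorem enc_succ (n : ℕ) : enc (n + 1) = .node .leaf (enc n) := rfl

/-- A unary number is a list of units. Counting loops thus become folds over lists, and lengths
become maps to `Unit`. -/
theorem enc_replicate (n : ℕ) : enc (List.replicate n ()) = enc n := by
  induction n with
  | zero => rfl
  | succ n ih => rw [List.replicate_succ, enc_cons, ih]; rfl

theorem size_enc_nat (n : ℕ) : (enc n).size = 2 * n + 1 := by
  induction n with
  | zero => rfl
  | succ n ih => simp only [enc_succ, Data.size, ih]; omega

instance : FaithfulEnc Bool :=
  ⟨fun a b h => by cases a <;> cases b <;> simp_all [enc_true, enc_false]⟩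

instance : FaithfulEnc ℕ :=
  ⟨fun a b h => by have := congrArg Data.size h; simp only [size_enc_nat] at this; omega⟩

instance [FaithfulEnc α] [FaithfulEnc β] : FaithfulEnc (α × β) :=
  ⟨fun a b h => by
    obtain ⟨a₁, a₂⟩ := a
    obtain ⟨b₁, b₂⟩ := b
    simp only [enc_prod, Data.node.injEq] at h
    rw [FaithfulEnc.inj h.1, FaithfulEnc.inj h.2]⟩

instance [FaithfulEnc α] : FaithfulEnc (List α) :=
  ⟨fun a => by
    induction a with
    | nil => intro b h; cases b <;> simp_all [enc_nil, enc_cons]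
    | cons x a ih =>
      intro b h
      cases b with
      | nil => simp [enc_nil, enc_cons] at h
      | cons y b =>
        simp only [enc_cons, Data.node.injEq] at h
        rw [FaithfulEnc.inj h.1, ih h.2]⟩

theorem size_enc_cons (a : α) (l : List α) :
    (enc (a :: l)).size = (enc a).size + (enc l).size + 1 := rfl

theorem size_enc_prod (a : α) (b : β) :
    (enc (a, b)).size = (enc a).size + (enc b).size + 1 := rfl

theorem size_enc_append (l l' : List α) :
    (enc (l ++ l')).size + 1 = (enc l).size + (enc l').size := by
  induction l with
  | nil => simp [enc_nil, Data.size, add_comm]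
  | cons a l ih => simp only [List.cons_append, size_enc_cons]; omega

theorem size_enc_le_of_mem {a : α} {l : List α} (h : a ∈ l) :
    (enc a).size + 2 ≤ (enc l).size := by
  induction l with
  | nil => simp at h
  | cons b l ih =>
    have := (enc l).one_le_size
    rw [size_enc_cons]
    rcases List.mem_cons.1 h with rfl | h
    · omega
    · have := ih h; omega

theorem two_mul_length_lt_size_enc (l : List α) : 2 * l.length < (enc l).size := by
  induction l with
  | nil => simp [enc_nil, Data.size]
  | cons a l ih =>
    have := (enc a).one_le_size
    simp only [size_enc_cons, List.length_cons]; omega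

theorem size_enc_list_le {l : List α} {B : ℕ} (h : ∀ a ∈ l, (enc a).size ≤ B) :
    (enc l).size ≤ l.length * (B + 1) + 1 := by
  induction l with
  | nil => simp [enc_nil, Data.size]
  | cons a l ih =>
    have h₁ := h a (by simp)
    have h₂ := ih fun b hb => h b (by simp [hb])
    simp only [size_enc_cons, List.length_cons, add_mul]
    omega

theorem size_enc_sublist {l l' : List α} (h : l.Sublist l') : (enc l).size ≤ (enc l').size := by
  induction h with
  | slnil => exact le_rfl
  | cons a _ ih => simp only [size_enc_cons]; omega
  | cons_cons a _ ih => simp only [size_enc_cons]; omega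

theorem size_enc_map_le {γ : Type} [Enc γ] (l : List γ) {g : γ → α} {g' : γ → β}
    (h : ∀ c ∈ l, (enc (g c)).size ≤ (enc (g' c)).size) :
    (enc (l.map g)).size ≤ (enc (l.map g')).size := by
  induction l with
  | nil => exact le_rfl
  | cons a l ih =>
    have h₁ := h a (by simp)
    have h₂ := ih fun b hb => h b (by simp [hb])
    simp only [List.map_cons, size_enc_cons]; omega

end Enc

/-- The function is computed by a program at a cost polynomial in the size of the argument. -/
def PolyTime {α β : Type} [Enc α] [Enc β] (f : α → β) : Prop :=
  ∃ (p : Prog) (q : Polynomial ℕ), ∀ a, ∃ t,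
    Eval p (enc a) t (enc (f a)) ∧ t ≤ q.eval (enc a).size

namespace PolyTime

variable {α β γ δ : Type} [Enc α] [Enc β] [Enc γ] [Enc δ]

theorem exists_size_le {f : α → β} (hf : PolyTime f) :
    ∃ q : Polynomial ℕ, ∀ a, (enc (f a)).size ≤ q.eval (enc a).size := by
  obtain ⟨p, q, h⟩ := hf
  refine ⟨q, fun a => ?_⟩
  obtain ⟨t, h₁, h₂⟩ := h a
  exact h₁.size_le.trans h₂

/-- A function that does not change the representation. -/
theorem of_enc_eq {f : α → β} (h : ∀ a, enc (f a) = enc a) : PolyTime f :=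
  ⟨.skip, Polynomial.X, fun a => ⟨_, by rw [h]; exact .skip _, by simp⟩⟩

protected theorem id : PolyTime (fun a : α => a) := of_enc_eq fun _ => rfl

theorem subtype_val {P : α → Prop} : PolyTime (fun a : {a // P a} => a.1) :=
  of_enc_eq fun _ => rfl

theorem comp {g : β → γ} {f : α → β} (hg : PolyTime g) (hf : PolyTime f) :
    PolyTime (fun a => g (f a)) := by
  obtain ⟨p, q, h⟩ := hf
  obtain ⟨p', q', h'⟩ := hg
  refine ⟨.seq p p', Polynomial.X + q + q'.comp q, fun a => ?_⟩
  obtain ⟨t, h₁, h₂⟩ := h a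
  obtain ⟨t', h₁', h₂'⟩ := h' (f a)
  refine ⟨_, .seq h₁ h₁', ?_⟩
  have := polynomial_eval_mono q' (h₁.size_le.trans h₂)
  simp only [Polynomial.eval_add, Polynomial.eval_X, Polynomial.eval_comp]
  omega

/-- Functions whose values have the same representation are computed by the same program. -/
theorem congr_enc {f : α → β} {g : α → γ} (hf : PolyTime f) (h : ∀ a, enc (g a) = enc (f a)) :
    PolyTime g := by
  obtain ⟨p, q, hf⟩ := hf
  exact ⟨p, q, fun a => by rw [h]; exact hf a⟩

theorem congr {f g : α → β} (hf : PolyTime f) (h : ∀ a, g a = f a) : PolyTime g :=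
  hf.congr_enc fun a => by rw [h]

theorem node {f : α → β} {g : α → γ} (hf : PolyTime f) (hg : PolyTime g) :
    PolyTime (fun a => Data.node (enc (f a)) (enc (g a))) := by
  obtain ⟨p, q, h⟩ := hf
  obtain ⟨p', q', h'⟩ := hg
  refine ⟨.pair p p', Polynomial.X + q + q', fun a => ?_⟩
  obtain ⟨t, h₁, h₂⟩ := h a
  obtain ⟨t', h₁', h₂'⟩ := h' a
  refine ⟨_, .pair h₁ h₁', ?_⟩
  simp only [Polynomial.eval_add, Polynomial.eval_X]
  omega

theorem pair {f : α → β} {g : α → γ} (hf : PolyTime f) (hg : PolyTime g) :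
    PolyTime (fun a => (f a, g a)) :=
  (hf.node hg).congr_enc fun _ => rfl

theorem cons {f : α → β} {g : α → List β} (hf : PolyTime f) (hg : PolyTime g) :
    PolyTime (fun a => f a :: g a) :=
  (hf.node hg).congr_enc fun _ => rfl

/-- The second alternative covers empty lists: the head of `leaf` is `leaf`, which also encodes the
default value `false`. -/
theorem hd_of_enc {f : α → γ} {g : α → β} (hf : PolyTime f)
    (h : ∀ a, (∃ d, enc (f a) = .node (enc (g a)) d) ∨ enc (f a) = .leaf ∧ enc (g a) = .leaf) :
    PolyTime g := by
  obtain ⟨p, q, hf⟩ := hf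
  refine ⟨.seq p .hd, Polynomial.X + q + q, fun a => ?_⟩
  obtain ⟨t, h₁, h₂⟩ := hf a
  have h₃ := h₁.size_le
  have : Eval .hd (enc (f a)) (enc (f a)).size (enc (g a)) := by
    rcases h a with ⟨d, h⟩ | ⟨h, h'⟩
    · rw [h]; exact .hd_node _ _
    · rw [h, h']; exact .hd_leaf
  refine ⟨_, .seq h₁ this, ?_⟩
  simp only [Polynomial.eval_add, Polynomial.eval_X]
  omega

theorem tl_of_enc {f : α → γ} {g : α → β} (hf : PolyTime f)
    (h : ∀ a, (∃ d, enc (f a) = .node d (enc (g a))) ∨ enc (f a) = .leaf ∧ enc (g a) = .leaf) :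
    PolyTime g := by
  obtain ⟨p, q, hf⟩ := hf
  refine ⟨.seq p .tl, Polynomial.X + q + q, fun a => ?_⟩
  obtain ⟨t, h₁, h₂⟩ := hf a
  have h₃ := h₁.size_le
  have : Eval .tl (enc (f a)) (enc (f a)).size (enc (g a)) := by
    rcases h a with ⟨d, h⟩ | ⟨h, h'⟩
    · rw [h]; exact .tl_node _ _
    · rw [h, h']; exact .tl_leaf
  refine ⟨_, .seq h₁ this, ?_⟩
  simp only [Polynomial.eval_add, Polynomial.eval_X]
  omega

theorem fst {f : α → β × γ} (hf : PolyTime f) : PolyTime (fun a => (f a).1) :=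
  hf.hd_of_enc fun _ => .inl ⟨_, rfl⟩

theorem snd {f : α → β × γ} (hf : PolyTime f) : PolyTime (fun a => (f a).2) :=
  hf.tl_of_enc fun _ => .inl ⟨_, rfl⟩

theorem tail {f : α → List β} (hf : PolyTime f) : PolyTime (fun a => (f a).tail) :=
  hf.tl_of_enc fun a => by
    cases f a with
    | nil => exact .inr ⟨rfl, rfl⟩
    | cons b l => exact .inl ⟨_, rfl⟩

theorem headD_false {f : α → List Bool} (hf : PolyTime f) :
    PolyTime (fun a => (f a).headD false) :=
  hf.hd_of_enc fun a => by
    cases f a with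
    | nil => exact .inr ⟨rfl, rfl⟩
    | cons b l => exact .inl ⟨_, rfl⟩

theorem const_data (d : Data) : PolyTime (fun _ : α => d) := by
  induction d with
  | leaf =>
    exact ⟨.nil, Polynomial.X, fun a => ⟨_, .nil _, by simp⟩⟩
  | node l r hl hr => exact hl.node hr

theorem const (b : β) : PolyTime (fun _ : α => b) :=
  (const_data (enc b)).congr_enc fun _ => rfl

theorem succ {f : α → ℕ} (hf : PolyTime f) : PolyTime (fun a => f a + 1) :=
  ((const_data .leaf).node hf).congr_enc fun _ => rfl

theorem cond {c : α → Bool} {f g : α → β} (hc : PolyTime c) (hf : PolyTime f)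
    (hg : PolyTime g) : PolyTime (fun a => if c a then f a else g a) := by
  obtain ⟨p, q, h⟩ := hf
  obtain ⟨p', q', h'⟩ := hg
  obtain ⟨p'', q'', h''⟩ := hc
  refine ⟨.cond p'' p p', Polynomial.X + q'' + q + q', fun a => ?_⟩
  obtain ⟨t, h₁, h₂⟩ := h a
  obtain ⟨t', h₁', h₂'⟩ := h' a
  obtain ⟨t'', h₁'', h₂''⟩ := h'' a
  simp only [Polynomial.eval_add, Polynomial.eval_X]
  cases hca : c a
  · rw [hca] at h₁''
    exact ⟨_, .cond_false h₁'' h₁', by omega⟩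
  · rw [hca] at h₁''
    exact ⟨_, .cond_true h₁'' h₁, by omega⟩

theorem not {c : α → Bool} (hc : PolyTime c) : PolyTime (fun a => !c a) :=
  (hc.cond (const false) (const true)).congr fun a => by cases c a <;> rfl

theorem and {c d : α → Bool} (hc : PolyTime c) (hd : PolyTime d) :
    PolyTime (fun a => c a && d a) :=
  (hc.cond hd (const false)).congr fun a => by cases c a <;> rfl

theorem or {c d : α → Bool} (hc : PolyTime c) (hd : PolyTime d) :
    PolyTime (fun a => c a || d a) :=
  (hc.cond (const true) hd).congr fun a => by cases c a <;> rfl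

theorem decide_eq [FaithfulEnc β] [DecidableEq β] {f g : α → β} (hf : PolyTime f)
    (hg : PolyTime g) : PolyTime (fun a => decide (f a = g a)) := by
  obtain ⟨p, q, h⟩ := hf.pair hg
  refine ⟨.seq p .eq, Polynomial.X + q + q, fun a => ?_⟩
  obtain ⟨t, h₁, h₂⟩ := h a
  have h₃ : (enc (f a, g a)).size ≤ t := h₁.size_le
  have : Eval .eq (enc (f a, g a)) (enc (f a, g a)).size (enc (decide (f a = g a))) := by
    by_cases hfg : f a = g a
    · rw [hfg, decide_eq_true rfl]; exact .eq_true _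
    · rw [decide_eq_false hfg]; exact .eq_false _ _ fun he => hfg (FaithfulEnc.inj he)
  refine ⟨_, .seq h₁ this, ?_⟩
  simp only [Polynomial.eval_add, Polynomial.eval_X]
  omega

theorem ite_eq [FaithfulEnc β] [DecidableEq β] {f g : α → β} {u v : α → γ} (hf : PolyTime f)
    (hg : PolyTime g) (hu : PolyTime u) (hv : PolyTime v) :
    PolyTime (fun a => if f a = g a then u a else v a) :=
  ((hf.decide_eq hg).cond hu hv).congr fun a => by simp

/-- Iteration over a list whose length and intermediate results are polynomially bounded. -/
theorem foldl_of_mem {l : α → List β} {g : α → γ → β → γ} {c : α → γ} (hl : PolyTime l)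
    (hc : PolyTime c)
    (hg : PolyTime (fun x : {x : α × γ × β // x.2.2 ∈ l x.1} => g x.1.1 x.1.2.1 x.1.2.2))
    (q : Polynomial ℕ)
    (hq : ∀ a l₁ l₂, l a = l₁ ++ l₂ → (enc (l₁.foldl (g a) (c a))).size ≤ q.eval (enc a).size) :
    PolyTime (fun a => (l a).foldl (g a) (c a)) := by
  obtain ⟨qB, hqB⟩ : ∃ r : Polynomial ℕ, ∀ a, (enc (l a)).size ≤ r.eval (enc a).size :=
    hl.exists_size_le
  -- The loop state consists of the argument, the accumulator and the rest of the list. The rest is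
  -- what the test `seq tl tl` returns; it is `leaf` exactly when the list is exhausted.
  have hbody : PolyTime
      (fun x : {x : α × γ × β × List β // x.2.2.1 ∈ l x.1} =>
        (x.1.1, g x.1.1 x.1.2.1 x.1.2.2.1, x.1.2.2.2)) := by
    have hx : PolyTime (fun x : {x : α × γ × β × List β // x.2.2.1 ∈ l x.1} => x.1) := subtype_val
    refine hx.fst.pair (.pair ?_ hx.snd.snd.snd)
    have : PolyTime (fun x : {x : α × γ × β × List β // x.2.2.1 ∈ l x.1} =>
        (⟨(x.1.1, x.1.2.1, x.1.2.2.1), x.2⟩ : {x : α × γ × β // x.2.2 ∈ l x.1})) :=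
      (hx.fst.pair (hx.snd.fst.pair hx.snd.snd.fst)).congr_enc fun _ => rfl
    exact hg.comp this
  obtain ⟨pb, qb, hb⟩ := hbody
  have hinit : PolyTime (fun a => (a, c a, l a)) := PolyTime.id.pair (hc.pair hl)
  -- sizes of the loop states and costs of the test
  let S : Polynomial ℕ := Polynomial.X + q + qB + 2
  let W : Polynomial ℕ := S + (S + S + S) + qb.comp S
  have hS : ∀ a l₁ l₂, l a = l₁ ++ l₂ →
      (enc (a, l₁.foldl (g a) (c a), l₂)).size ≤ S.eval (enc a).size := by
    intro a l₁ l₂ h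
    have h₁ := hq a l₁ l₂ h
    have h₂ := hqB a
    have h₃ : (enc l₂).size ≤ (enc (l a)).size := by
      rw [h]; exact size_enc_sublist (List.sublist_append_right _ _)
    simp only [size_enc_prod, S, Polynomial.eval_add, Polynomial.eval_X, Polynomial.eval_ofNat]
    omega
  have htest : ∀ x y z : Data, Eval (.seq .tl .tl) (.node x (.node y z))
      ((Data.node x (.node y z)).size + (Data.node x (.node y z)).size + (Data.node y z).size)
      z := fun x y z => .seq (.tl_node _ _) (.tl_node _ _)
  -- The processed prefix `l₁` stays in the statement because sizes are controlled only for prefixes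
  -- of `l a`, and the body is available only for members of `l a`.
  have hloop : ∀ a l₂ l₁, l a = l₁ ++ l₂ → ∃ t,
      Eval (.loop (.seq .tl .tl) pb) (enc (a, l₁.foldl (g a) (c a), l₂)) t
        (enc (a, (l a).foldl (g a) (c a), ([] : List β))) ∧
      t ≤ (l₂.length + 1) * W.eval (enc a).size := by
    intro a l₂
    induction l₂ with
    | nil =>
      intro l₁ h
      have h₁ := hS a l₁ [] h
      rw [List.append_nil] at h
      rw [h]
      refine ⟨_, .loop_done (htest _ _ _), ?_⟩
      simp only [enc_prod, Data.size] at h₁ ⊢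
      simp only [W, Polynomial.eval_add, List.length_nil, zero_add, one_mul]
      omega
    | cons b l₂ ih =>
      intro l₁ h
      have h₁ := hS a l₁ (b :: l₂) h
      obtain ⟨t, ht, ht'⟩ := ih (l₁ ++ [b]) (by simp [h])
      obtain ⟨s, hs, hs'⟩ := hb ⟨(a, l₁.foldl (g a) (c a), b, l₂), by simp [h]⟩
      rw [List.foldl_append] at ht
      refine ⟨_, .loop_step (htest _ _ _) hs ht, ?_⟩
      have h₂ := hs'.trans (polynomial_eval_mono qb h₁)
      simp only [enc_prod, Data.size] at h₁ ⊢
      rw [List.length_cons, add_mul _ 1, one_mul]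
      have h₃ : W.eval (enc a).size = S.eval (enc a).size + (S.eval (enc a).size +
          S.eval (enc a).size + S.eval (enc a).size) + qb.eval (S.eval (enc a).size) := by
        simp [W]
      omega
  have hmain : PolyTime (fun a => (a, (l a).foldl (g a) (c a), ([] : List β))) := by
    obtain ⟨pi, qi, hi⟩ := hinit
    refine ⟨.seq pi (.loop (.seq .tl .tl) pb), Polynomial.X + qi + (qB + 1) * W, fun a => ?_⟩
    obtain ⟨t, h₁, h₂⟩ := hi a
    obtain ⟨s, h₃, h₄⟩ := hloop a (l a) [] rfl
    refine ⟨_, .seq h₁ h₃, ?_⟩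
    have h₅ : (l a).length + 1 ≤ (qB + 1 : Polynomial ℕ).eval (enc a).size := by
      have := hqB a
      have := two_mul_length_lt_size_enc (l a)
      simp only [Polynomial.eval_add, Polynomial.eval_one]
      omega
    have h₆ := h₄.trans (Nat.mul_le_mul_right _ h₅)
    rw [Polynomial.eval_add, Polynomial.eval_mul, Polynomial.eval_add, Polynomial.eval_X]
    omega
  exact hmain.snd.fst

theorem foldl {l : α → List β} {g : α → γ → β → γ} {c : α → γ} (hl : PolyTime l)
    (hc : PolyTime c) (hg : PolyTime (fun x : α × γ × β => g x.1 x.2.1 x.2.2))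
    (q : Polynomial ℕ)
    (hq : ∀ a l₁ l₂, l a = l₁ ++ l₂ → (enc (l₁.foldl (g a) (c a))).size ≤ q.eval (enc a).size) :
    PolyTime (fun a => (l a).foldl (g a) (c a)) :=
  foldl_of_mem hl hc (hg.comp subtype_val) q hq

theorem reverse {l : α → List β} (hl : PolyTime l) : PolyTime (fun a => (l a).reverse) := by
  obtain ⟨q, hq⟩ := hl.exists_size_le
  refine (foldl (g := fun _ acc b => b :: acc) (c := fun _ => []) hl (const [])
    (PolyTime.id.snd.snd.cons PolyTime.id.snd.fst) q ?_).congr fun a => by simp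
  intro a l₁ l₂ h
  have h₁ : ∀ l : List β, (enc l.reverse).size = (enc l).size := by
    intro l
    induction l with
    | nil => rfl
    | cons b l ih =>
      have := size_enc_append l.reverse [b]
      simp only [List.reverse_cons, size_enc_cons] at this ⊢
      have h₀ : (enc ([] : List β)).size = 1 := rfl
      omega
  have h₂ : l₁.foldl (fun acc b => b :: acc) [] = l₁.reverse := by simp
  rw [h₂, h₁]
  refine le_trans ?_ (hq a)
  rw [h]
  exact size_enc_sublist (List.sublist_append_left _ _)

theorem append {l l' : α → List β} (hl : PolyTime l) (hl' : PolyTime l') :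
    PolyTime (fun a => l a ++ l' a) := by
  obtain ⟨q, hq⟩ := hl.reverse.exists_size_le
  obtain ⟨q', hq'⟩ := hl'.exists_size_le
  refine (foldl (g := fun _ acc b => b :: acc) (c := l') hl.reverse hl'
    (PolyTime.id.snd.snd.cons PolyTime.id.snd.fst) (q + q') ?_).congr fun a => by simp
  intro a l₁ l₂ h
  have h₁ : ∀ (m m' : List β), (enc (m.foldl (fun acc b => b :: acc) m')).size + 1 =
      (enc m).size + (enc m').size := by
    intro m
    induction m with
    | nil => intro m'; simp [enc_nil, Data.size, add_comm]
    | cons b m ih =>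
      intro m'
      have := ih (b :: m')
      simp only [List.foldl_cons, size_enc_cons] at this ⊢
      omega
  have h₂ := h₁ l₁ (l' a)
  have h₃ := hq a
  have h₄ := hq' a
  have h₅ : (enc l₁).size ≤ (enc (l a).reverse).size := by
    rw [h]; exact size_enc_sublist (List.sublist_append_left _ _)
  simp only [Polynomial.eval_add]
  omega

/-- Requiring `g` only on members of the list lets a promise about all members be used for each of
them; the bound on the widths of the levels enters in this way. -/
theorem flatMap_of_mem {l : α → List β} {g : α → β → List γ} (hl : PolyTime l)
    (hg : PolyTime (fun x : {x : α × β // x.2 ∈ l x.1} => g x.1.1 x.1.2)) :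
    PolyTime (fun a => (l a).flatMap (g a)) := by
  obtain ⟨q, hq⟩ := hl.exists_size_le
  obtain ⟨r, hr⟩ := hg.exists_size_le
  have hfold : ∀ (m : List β) (h : β → List γ) (m' : List γ),
      m.foldl (fun acc b => acc ++ h b) m' = m' ++ m.flatMap h := by
    intro m h
    induction m with
    | nil => simp
    | cons b m ih => intro m'; simp [ih]
  have hx : PolyTime (fun x : {x : α × List γ × β // x.2.2 ∈ l x.1} => x.1) := subtype_val
  have hx' : PolyTime (fun x : {x : α × List γ × β // x.2.2 ∈ l x.1} =>
      (⟨(x.1.1, x.1.2.2), x.2⟩ : {x : α × β // x.2 ∈ l x.1})) :=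
    (hx.fst.pair hx.snd.snd).congr_enc fun _ => rfl
  refine (foldl_of_mem (g := fun a acc b => acc ++ g a b) (c := fun _ => []) hl (const [])
    (hx.snd.fst.append (hg.comp hx')) (q * r.comp (Polynomial.X + q + 1) + 1) ?_).congr
    fun a => by rw [hfold]; simp
  intro a l₁ l₂ h
  rw [hfold, List.nil_append]
  have hsub : l₁.Sublist (l a) := by rw [h]; exact List.sublist_append_left _ _
  have h₁ : ∀ b ∈ l a, (enc (g a b)).size ≤ r.eval ((enc a).size + q.eval (enc a).size + 1) := by
    intro b hb
    refine (hr ⟨(a, b), hb⟩).trans (polynomial_eval_mono r ?_)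
    have := size_enc_le_of_mem hb
    have := hq a
    simp only [enc_subtype, size_enc_prod]
    omega
  have h₂ : ∀ (m : List β) (B : ℕ), (∀ b ∈ m, (enc (g a b)).size ≤ B) →
      (enc (m.flatMap (g a))).size ≤ m.length * B + 1 := by
    intro m B
    induction m with
    | nil => intro _; simp [enc_nil, Data.size]
    | cons b m ih =>
      intro hm
      have h₁ := hm b (by simp)
      have h₂ := ih fun c hc => hm c (by simp [hc])
      have h₃ := size_enc_append (g a b) (m.flatMap (g a))
      simp only [List.flatMap_cons, List.length_cons, add_mul, one_mul]
      omega
  refine (h₂ l₁ _ fun b hb => h₁ b (hsub.subset hb)).trans ?_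
  simp only [Polynomial.eval_add, Polynomial.eval_mul, Polynomial.eval_comp, Polynomial.eval_X,
    Polynomial.eval_one]
  gcongr
  have := hsub.length_le
  have := two_mul_length_lt_size_enc (l a)
  have := hq a
  omega

theorem flatMap {l : α → List β} {g : α → β → List γ} (hl : PolyTime l)
    (hg : PolyTime (fun x : α × β => g x.1 x.2)) : PolyTime (fun a => (l a).flatMap (g a)) :=
  flatMap_of_mem hl (hg.comp subtype_val)

theorem map_of_mem {l : α → List β} {g : α → β → γ} (hl : PolyTime l)
    (hg : PolyTime (fun x : {x : α × β // x.2 ∈ l x.1} => g x.1.1 x.1.2)) :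
    PolyTime (fun a => (l a).map (g a)) :=
  (flatMap_of_mem (g := fun a b => [g a b]) hl (hg.cons (const []))).congr fun a => by
    induction l a <;> simp_all

theorem map {l : α → List β} {g : α → β → γ} (hl : PolyTime l)
    (hg : PolyTime (fun x : α × β => g x.1 x.2)) : PolyTime (fun a => (l a).map (g a)) :=
  map_of_mem hl (hg.comp subtype_val)

theorem filter {l : α → List β} {g : α → β → Bool} (hl : PolyTime l)
    (hg : PolyTime (fun x : α × β => g x.1 x.2)) : PolyTime (fun a => (l a).filter (g a)) :=
  (flatMap (g := fun a b => if g a b then [b] else []) hl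
    (hg.cond (PolyTime.id.snd.cons (const [])) (const []))).congr fun a => by
    induction l a with
    | nil => rfl
    | cons b m ih => cases h : g a b <;> simp [h, ih]

theorem any {l : α → List β} {g : α → β → Bool} (hl : PolyTime l)
    (hg : PolyTime (fun x : α × β => g x.1 x.2)) : PolyTime (fun a => (l a).any (g a)) := by
  refine (foldl (g := fun a acc b => acc || g a b) (c := fun _ => false) hl (const false)
    (PolyTime.id.snd.fst.or (hg.comp (PolyTime.id.fst.pair PolyTime.id.snd.snd))) 3 ?_).congr
    fun a => ?_
  · intro a l₁ l₂ _
    simp only [Polynomial.eval_ofNat]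
    cases l₁.foldl (fun acc b => acc || g a b) false <;> simp [enc_true, enc_false, Data.size]
  · have : ∀ (m : List β) (c : Bool),
        m.foldl (fun acc b => acc || g a b) c = (c || m.any (g a)) := by
      intro m
      induction m with
      | nil => simp
      | cons b m ih => intro c; simp [ih, Bool.or_assoc]
    rw [this, Bool.false_or]

theorem length {l : α → List β} (hl : PolyTime l) : PolyTime (fun a => (l a).length) :=
  (map (g := fun _ _ => ()) hl (const ())).congr_enc fun a => by
    rw [List.map_const', enc_replicate]

theorem ite_mem [FaithfulEnc β] [DecidableEq β] {b : α → β} {l : α → List β} {u v : α → γ}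
    (hb : PolyTime b) (hl : PolyTime l) (hu : PolyTime u) (hv : PolyTime v) :
    PolyTime (fun a => if b a ∈ l a then u a else v a) :=
  ((any (g := fun a c => decide (c = b a)) hl
    (PolyTime.id.snd.decide_eq (hb.comp PolyTime.id.fst))).cond hu hv).congr fun a => by
    simp

end PolyTime

/-! ## Construction of the diagram of a list of clauses -/

/-- The list of the tails of those incidence vectors (clauses) that are not yet satisfied. -/
abbrev State := List (List Bool)

/-- References to the nodes of a diagram under construction. -/
inductive Ref where
  | bot : Ref
  | top : Ref
  | inner (i : ℕ) : Ref
  deriving DecidableEq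

/-- The layer and the two children of an inner node. -/
abbrev Key := ℕ × Ref × Ref

instance : Enc Ref := ⟨fun r => match r with
  | .bot => .leaf
  | .top => .node .leaf .leaf
  | .inner i => .node (.node .leaf .leaf) (encNat i)⟩

theorem enc_ref_inner (i : ℕ) : enc (Ref.inner i) = .node (.node .leaf .leaf) (enc i) := rfl

instance : FaithfulEnc Ref := ⟨fun a b h => by
  cases a with
  | inner i =>
    cases b with
    | inner j =>
      rw [enc_ref_inner, enc_ref_inner, Data.node.injEq] at h
      rw [FaithfulEnc.inj h.2]
    | _ => cases h
  | _ => cases b <;> first | rfl | cases h⟩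

/-- A list with an unsatisfiable clause is replaced by a canonical one. -/
def norm (s : State) : State := if s.any (fun r => !r.any id) then [[]] else s

/-- The clauses that remain after the first variable has been given the value `b`. -/
def cofactor (b : Bool) (s : State) : State :=
  norm ((s.filter fun r => !(b && r.headD false)).map List.tail)

/-- The list is neither trivially satisfied nor trivially unsatisfiable. -/
def isInner (s : State) : Bool := !decide (s = []) && !decide (s = [[]])

def dedup {α : Type} [DecidableEq α] (l : List α) : List α :=
  l.foldl (fun acc a => if a ∈ acc then acc else a :: acc) []

/-- Removing duplicates keeps a level as small as its number of distinct states. Trivial states are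
leaves and need no entry. -/
def expand (L : List State) : List State :=
  (dedup (L.flatMap fun s => [cofactor false s, cofactor true s])).filter isInner

/-- The non-trivial lists of clauses that arise by fixing the first `i` variables. -/
def level (rows : State) : ℕ → List State
  | 0 => [norm rows].filter isInner
  | i + 1 => expand (level rows i)

/-- The lists of clauses of the first levels together with their level, the last level first. -/
def allStates (rows : State) : ℕ → List (ℕ × State)
  | 0 => []
  | i + 1 => (level rows i).map (fun s => (i, s)) ++ allStates rows i

/-- Among several entries for `a` the last in the list wins, that is, the oldest when entries are
added at the front. -/
def lookupD {α β : Type} [DecidableEq α] (a : α) (d : β) (l : List (α × β)) : β :=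
  l.foldl (fun acc e => if e.1 = a then e.2 else acc) d

/-- The node belonging to a list of clauses. -/
def refOf (assoc : List ((ℕ × State) × Ref)) (p : ℕ × State) : Ref :=
  lookupD p (if p.2 = [] then Ref.top else Ref.bot) assoc

/-- The node with the given layer and children. -/
def findRef (nodes : List (Key × Ref)) (k : Key) : Ref :=
  if k.2.1 = k.2.2 then k.2.1 else lookupD k (Ref.inner nodes.length) nodes

/-- The layer and the children of the node of a list of clauses. -/
def keyOf (assoc : List ((ℕ × State) × Ref)) (p : ℕ × State) : Key :=
  (p.1, refOf assoc (p.1 + 1, cofactor false p.2), refOf assoc (p.1 + 1, cofactor true p.2))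

/-- Assign a node to a list of clauses, creating it if it does not exist yet. -/
def assign (acc : List ((ℕ × State) × Ref) × List (Key × Ref)) (p : ℕ × State) :
    List ((ℕ × State) × Ref) × List (Key × Ref) :=
  ((p, findRef acc.2 (keyOf acc.1 p)) :: acc.1,
    if findRef acc.2 (keyOf acc.1 p) = Ref.inner acc.2.length then
      (keyOf acc.1 p, findRef acc.2 (keyOf acc.1 p)) :: acc.2 else acc.2)

def assignAll (l : List (ℕ × State)) : List ((ℕ × State) × Ref) × List (Key × Ref) :=
  l.foldl assign ([], [])

/-- The root and the inner nodes of the diagram. -/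
def buildDiagram (n : ℕ) (rows : State) : Ref × List Key :=
  (refOf (assignAll (allStates rows n)).1 (0, norm rows),
    (assignAll (allStates rows n)).2.reverse.map fun e => e.1)

/-! ## The construction takes polynomial time -/

namespace PolyTime

variable {α β γ : Type} [Enc α] [Enc β] [Enc γ]

theorem norm {s : α → State} (hs : PolyTime s) : PolyTime (fun a => norm (s a)) :=
  (any (g := fun _ (r : List Bool) => !r.any id) hs
    (any (g := fun _ (b : Bool) => b) PolyTime.id.snd PolyTime.id.snd).not).cond (const [[]]) hs

theorem cofactor {s : α → State} (b : Bool) (hs : PolyTime s) :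
    PolyTime (fun a => cofactor b (s a)) :=
  norm (map (g := fun _ r => r.tail)
    (filter (g := fun _ r => !(b && r.headD false)) hs
      ((const b).and PolyTime.id.snd.headD_false).not) PolyTime.id.snd.tail)

theorem isInner {s : α → State} (hs : PolyTime s) : PolyTime (fun a => isInner (s a)) :=
  (hs.decide_eq (const [])).not.and (hs.decide_eq (const [[]])).not

theorem lookupD [DecidableEq β] [FaithfulEnc β] {b : α → β} {d : α → γ} {l : α → List (β × γ)}
    (hb : PolyTime b) (hd : PolyTime d) (hl : PolyTime l) :
    PolyTime (fun a => lookupD (b a) (d a) (l a)) := by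
  obtain ⟨q, hq⟩ := hl.exists_size_le
  obtain ⟨r, hr⟩ := hd.exists_size_le
  refine foldl (g := fun a acc e => if e.1 = b a then e.2 else acc) hl hd
    (ite_eq PolyTime.id.snd.snd.fst (hb.comp PolyTime.id.fst) PolyTime.id.snd.snd.snd
      PolyTime.id.snd.fst) (q + r) ?_
  intro a l₁ l₂ h
  have h₁ : ∀ (m : List (β × γ)) (c : γ) (B : ℕ), (enc m).size ≤ B → (enc c).size ≤ B →
      (enc (m.foldl (fun acc e => if e.1 = b a then e.2 else acc) c)).size ≤ B := by
    intro m
    induction m with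
    | nil => intro c B _ h; exact h
    | cons e m ih =>
      intro c B h h'
      rw [List.foldl_cons]
      have he : (enc e).size = (enc e.1).size + (enc e.2).size + 1 := rfl
      rw [size_enc_cons] at h
      refine ih _ B (by omega) ?_
      split_ifs
      · omega
      · exact h'
  have h₂ : (enc l₁).size ≤ (enc (l a)).size := by
    rw [h]; exact size_enc_sublist (List.sublist_append_left _ _)
  have h₃ := hq a
  have h₄ := hr a
  rw [Polynomial.eval_add]
  exact h₁ _ _ _ (by omega) (by omega)

end PolyTime

/-! ### Removing duplicates -/

section Dedup

variable {α : Type} [DecidableEq α]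

/-- Bounds the encoded size of every intermediate result of `dedup`. -/
theorem foldl_insert_sublist (l acc : List α) :
    (l.foldl (fun acc a => if a ∈ acc then acc else a :: acc) acc).Sublist
      (l.reverse ++ acc) := by
  induction l generalizing acc with
  | nil => exact List.Sublist.refl _
  | cons a l ih =>
    rw [List.foldl_cons, List.reverse_cons, List.append_assoc]
    refine (ih _).trans (List.Sublist.append_left ?_ _)
    split_ifs
    · exact List.sublist_cons_self _ _
    · exact List.Sublist.refl _

theorem mem_foldl_insert {l acc : List α} {b : α} :
    b ∈ l.foldl (fun acc a => if a ∈ acc then acc else a :: acc) acc ↔ b ∈ l ∨ b ∈ acc := by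
  induction l generalizing acc with
  | nil => simp
  | cons a l ih =>
    rw [List.foldl_cons, ih]
    split_ifs with h
    · simp only [List.mem_cons]
      constructor
      · tauto
      · rintro ((rfl | h') | h') <;> tauto
    · simp only [List.mem_cons]; tauto

theorem nodup_foldl_insert {l acc : List α} (h : acc.Nodup) :
    (l.foldl (fun acc a => if a ∈ acc then acc else a :: acc) acc).Nodup := by
  induction l generalizing acc with
  | nil => exact h
  | cons a l ih =>
    rw [List.foldl_cons]
    refine ih ?_
    split_ifs with h'
    · exact h
    · exact List.nodup_cons.2 ⟨h', h⟩

theorem mem_dedup {l : List α} {b : α} : b ∈ dedup l ↔ b ∈ l := by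
  simp [dedup, mem_foldl_insert]

theorem nodup_dedup (l : List α) : (dedup l).Nodup := nodup_foldl_insert List.nodup_nil

end Dedup

namespace PolyTime

variable {α β γ : Type} [Enc α] [Enc β] [Enc γ]

theorem dedup [DecidableEq β] [FaithfulEnc β] {l : α → List β} (hl : PolyTime l) :
    PolyTime (fun a => dedup (l a)) := by
  obtain ⟨q, hq⟩ := hl.reverse.exists_size_le
  refine foldl (g := fun _ acc b => if b ∈ acc then acc else b :: acc) (c := fun _ => []) hl
    (const []) (ite_mem PolyTime.id.snd.snd PolyTime.id.snd.fst PolyTime.id.snd.fst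
      (PolyTime.id.snd.snd.cons PolyTime.id.snd.fst)) q ?_
  intro a l₁ l₂ h
  refine le_trans (size_enc_sublist ?_) (hq a)
  refine (foldl_insert_sublist l₁ []).trans ?_
  rw [h, List.append_nil, List.reverse_append]
  exact List.sublist_append_right _ _

theorem expand {L : α → List State} (hL : PolyTime L) : PolyTime (fun a => expand (L a)) :=
  filter (g := fun _ s => ScenarioAgg.isInner s)
    (dedup (flatMap
      (g := fun _ s => [ScenarioAgg.cofactor false s, ScenarioAgg.cofactor true s]) hL
      ((cofactor false PolyTime.id.snd).cons ((cofactor true PolyTime.id.snd).cons (const [])))))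
    (isInner PolyTime.id.snd)

theorem inner {f : α → ℕ} (hf : PolyTime f) : PolyTime (fun a => Ref.inner (f a)) :=
  ((const_data (.node .leaf .leaf)).node hf).congr_enc fun _ => rfl

theorem refOf {assoc : α → List ((ℕ × State) × Ref)} {p : α → ℕ × State}
    (ha : PolyTime assoc) (hp : PolyTime p) : PolyTime (fun a => refOf (assoc a) (p a)) :=
  lookupD hp (ite_eq hp.snd (const []) (const Ref.top) (const Ref.bot)) ha

theorem findRef {nodes : α → List (Key × Ref)} {k : α → Key}
    (hn : PolyTime nodes) (hk : PolyTime k) : PolyTime (fun a => findRef (nodes a) (k a)) :=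
  ite_eq hk.snd.fst hk.snd.snd hk.snd.fst (lookupD hk hn.length.inner hn)

theorem keyOf {assoc : α → List ((ℕ × State) × Ref)} {p : α → ℕ × State}
    (ha : PolyTime assoc) (hp : PolyTime p) : PolyTime (fun a => keyOf (assoc a) (p a)) :=
  hp.fst.pair ((ha.refOf (hp.fst.succ.pair (cofactor false hp.snd))).pair
    (ha.refOf (hp.fst.succ.pair (cofactor true hp.snd))))

theorem assign {acc : α → List ((ℕ × State) × Ref) × List (Key × Ref)} {p : α → ℕ × State}
    (ha : PolyTime acc) (hp : PolyTime p) : PolyTime (fun a => assign (acc a) (p a)) :=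
  have hk := ha.fst.keyOf hp
  have hr := ha.snd.findRef hk
  ((hp.pair hr).cons ha.fst).pair
    (ite_eq hr ha.snd.length.inner ((hk.pair hr).cons ha.snd) ha.snd)

end PolyTime

/-! ### Bounds on the node tables -/

theorem lookupD_cases {α β : Type} [DecidableEq α] (a : α) (d : β) (l : List (α × β)) :
    lookupD a d l = d ∨ (a, lookupD a d l) ∈ l := by
  induction l generalizing d with
  | nil => exact .inl rfl
  | cons e l ih =>
    have h : lookupD a d (e :: l) = lookupD a (if e.1 = a then e.2 else d) l := rfl
    rw [h]
    rcases ih (if e.1 = a then e.2 else d) with h' | h'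
    · rw [h']
      split_ifs with he
      · right; subst he; exact List.mem_cons_self
      · exact .inl rfl
    · exact .inr (List.mem_cons_of_mem _ h')

/-- The reference is a leaf or one of the first `m` inner nodes. -/
def Ref.Valid (m : ℕ) : Ref → Prop
  | .inner i => i < m
  | _ => True

theorem Ref.Valid.mono {m m' : ℕ} {r : Ref} (h : r.Valid m) (hm : m ≤ m') : r.Valid m' := by
  cases r with
  | inner i => exact lt_of_lt_of_le h hm
  | _ => trivial

theorem Ref.Valid.size_le {m : ℕ} {r : Ref} (h : r.Valid m) : (enc r).size ≤ 2 * m + 5 := by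
  cases r with
  | inner i =>
    have : i < m := h
    simp only [enc_ref_inner, Data.size, size_enc_nat]; omega
  | bot => have : (enc Ref.bot).size = 1 := rfl
           omega
  | top => have : (enc Ref.top).size = 3 := rfl
           omega

theorem refOf_valid {assoc : List ((ℕ × State) × Ref)} {m : ℕ}
    (h : ∀ e ∈ assoc, e.2.Valid m) (p : ℕ × State) : (refOf assoc p).Valid m := by
  rcases lookupD_cases p (if p.2 = [] then Ref.top else Ref.bot) assoc with h' | h'
  · rw [refOf, h']
    split_ifs <;> trivial
  · exact h _ h'

theorem findRef_valid {nodes : List (Key × Ref)} {m : ℕ} (hm : nodes.length < m)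
    (h : ∀ e ∈ nodes, e.2.Valid m) {k : Key} (hk : k.2.1.Valid m) :
    (findRef nodes k).Valid m := by
  rw [findRef]
  split_ifs
  · exact hk
  · rcases lookupD_cases k (Ref.inner nodes.length) nodes with h' | h'
    · rw [h']; exact hm
    · exact h _ h'

/-- The tables contain at most `m` entries, all of them referring to the first `m` inner nodes
and to layers and lists of clauses in `l`. -/
structure TablesBounded (l : List (ℕ × State)) (m : ℕ)
    (acc : List ((ℕ × State) × Ref) × List (Key × Ref)) : Prop where
  length_fst : acc.1.length ≤ m
  length_snd : acc.2.length ≤ m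
  valid_fst : ∀ e ∈ acc.1, e.2.Valid m
  valid_snd : ∀ e ∈ acc.2, e.2.Valid m ∧ e.1.2.1.Valid m ∧ e.1.2.2.Valid m
  mem_fst : ∀ e ∈ acc.1, e.1 ∈ l
  mem_snd : ∀ e ∈ acc.2, ∃ s, (e.1.1, s) ∈ l

theorem TablesBounded.assign {l : List (ℕ × State)} {m : ℕ}
    {acc : List ((ℕ × State) × Ref) × List (Key × Ref)} (h : TablesBounded l m acc)
    {p : ℕ × State} (hp : p ∈ l) : TablesBounded l (m + 1) (assign acc p) := by
  have hv : ∀ q, (refOf acc.1 q).Valid (m + 1) := fun q =>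
    (refOf_valid h.valid_fst q).mono m.le_succ
  have hr : (findRef acc.2 (keyOf acc.1 p)).Valid (m + 1) :=
    findRef_valid (Nat.lt_succ_of_le h.length_snd)
      (fun e he => (h.valid_snd e he).1.mono m.le_succ) (hv _)
  have hold : ∀ e ∈ acc.2, e.2.Valid (m + 1) ∧ e.1.2.1.Valid (m + 1) ∧ e.1.2.2.Valid (m + 1) :=
    fun e he => ⟨(h.valid_snd e he).1.mono m.le_succ, (h.valid_snd e he).2.1.mono m.le_succ,
      (h.valid_snd e he).2.2.mono m.le_succ⟩
  have h₂ := h.length_snd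
  constructor
  · exact Nat.succ_le_succ h.length_fst
  · simp only [ScenarioAgg.assign]
    split_ifs
    · rw [List.length_cons]; omega
    · omega
  · intro e he
    rcases List.mem_cons.1 he with rfl | he
    · exact hr
    · exact (h.valid_fst e he).mono m.le_succ
  · intro e he
    simp only [ScenarioAgg.assign] at he
    split_ifs at he
    · rcases List.mem_cons.1 he with rfl | he
      · exact ⟨hr, hv _, hv _⟩
      · exact hold e he
    · exact hold e he
  · intro e he
    rcases List.mem_cons.1 he with rfl | he
    · exact hp
    · exact h.mem_fst e he
  · intro e he
    simp only [ScenarioAgg.assign] at he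
    split_ifs at he
    · rcases List.mem_cons.1 he with rfl | he
      · exact ⟨p.2, hp⟩
      · exact h.mem_snd e he
    · exact h.mem_snd e he

theorem tablesBounded_foldl {l : List (ℕ × State)} (l₁ : List (ℕ × State)) (h : l₁ ⊆ l) :
    TablesBounded l l₁.length (l₁.foldl assign ([], [])) := by
  induction l₁ using List.reverseRecOn with
  | nil => constructor <;> simp
  | append_singleton l₁ p ih =>
    rw [List.foldl_append, List.length_append]
    exact (ih fun x hx => h (by simp [hx])).assign (h (by simp))

/-- An entry of the node table contains three references of size at most `2 * m + 5`, whence `6 *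
m`; its layer is bounded by the size of `l`. -/
theorem TablesBounded.size_le {l : List (ℕ × State)} {m : ℕ}
    {acc : List ((ℕ × State) × Ref) × List (Key × Ref)} (h : TablesBounded l m acc) :
    (enc acc).size ≤ 2 * (m * ((enc l).size + 6 * m + 20)) + 3 := by
  have h₁ : (enc acc.1).size ≤ acc.1.length * ((enc l).size + 6 * m + 19 + 1) + 1 := by
    refine size_enc_list_le fun e he => ?_
    have h₁ := size_enc_le_of_mem (h.mem_fst e he)
    have h₂ := (h.valid_fst e he).size_le
    have h₃ : (enc e).size = (enc e.1).size + (enc e.2).size + 1 := rfl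
    omega
  have h₂ : (enc acc.2).size ≤ acc.2.length * ((enc l).size + 6 * m + 19 + 1) + 1 := by
    refine size_enc_list_le fun e he => ?_
    obtain ⟨s, hs⟩ := h.mem_snd e he
    have h₁ := size_enc_le_of_mem hs
    obtain ⟨h₂, h₃, h₄⟩ := h.valid_snd e he
    have h₂ := h₂.size_le
    have h₃ := h₃.size_le
    have h₄ := h₄.size_le
    have h₅ : (enc e).size = ((enc e.1.1).size +
      ((enc e.1.2.1).size + (enc e.1.2.2).size + 1) + 1) + (enc e.2).size + 1 := rfl
    rw [size_enc_prod] at h₁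
    omega
  have h₃ := Nat.mul_le_mul_right ((enc l).size + 6 * m + 19 + 1) h.length_fst
  have h₄ := Nat.mul_le_mul_right ((enc l).size + 6 * m + 19 + 1) h.length_snd
  have h₅ : (enc acc).size = (enc acc.1).size + (enc acc.2).size + 1 := rfl
  rw [show (enc l).size + 6 * m + 20 = (enc l).size + 6 * m + 19 + 1 from rfl]
  omega

/-- The bounds on the tables hold for arbitrary lists of states, so the correctness of the tables is
not needed here. -/
theorem polyTime_assignAll : PolyTime assignAll := by
  refine PolyTime.foldl (α := List (ℕ × State)) (l := fun l => l) (g := fun _ => assign)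
    (c := fun _ => ([], [])) PolyTime.id (PolyTime.const _)
    (PolyTime.id.snd.fst.assign PolyTime.id.snd.snd)
    (2 * (Polynomial.X * (Polynomial.X + 6 * Polynomial.X + 20)) + 3) ?_
  intro l l₁ l₂ h
  have h₁ := (tablesBounded_foldl (l := l) l₁ (by rw [h]; simp)).size_le
  have h₂ := two_mul_length_lt_size_enc l
  have h₃ : l₁.length ≤ (enc l).size := by rw [h, List.length_append] at h₂; rw [h]; omega
  refine h₁.trans ?_
  simp only [Polynomial.eval_add, Polynomial.eval_mul, Polynomial.eval_X, Polynomial.eval_ofNat]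
  gcongr

/-! ### Sizes of the levels -/

theorem size_norm_le (s : State) : (enc (norm s)).size ≤ (enc s).size := by
  rw [norm]
  split_ifs with h
  · cases s with
    | nil => simp at h
    | cons r s =>
      have := (enc r).one_le_size
      have := (enc s).one_le_size
      have h₀ : (enc ([[]] : State)).size = 3 := rfl
      rw [size_enc_cons r s]; omega
  · exact le_rfl

theorem size_cofactor_le (b : Bool) (s : State) :
    (enc (cofactor b s)).size ≤ (enc s).size := by
  refine (size_norm_le _).trans (le_trans (b := (enc (s.filter
    fun r => !(b && r.headD false))).size) ?_ (size_enc_sublist List.filter_sublist))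
  have := size_enc_map_le (s.filter fun r => !(b && r.headD false)) (g := List.tail)
    (g' := fun r => r) fun r _ => size_enc_sublist (List.tail_sublist r)
  rwa [List.map_id'] at this

/-- Cofactors only delete clauses, shorten them, or collapse the list to `[[]]`. Only the number of
states in a level can become large. -/
theorem size_le_of_mem_level {rows s : State} {i : ℕ} (h : s ∈ level rows i) :
    (enc s).size ≤ (enc rows).size := by
  induction i generalizing s with
  | zero =>
    simp only [level, List.mem_filter, List.mem_singleton] at h
    rw [h.1]; exact size_norm_le _
  | succ i ih =>
    simp only [level, expand, List.mem_filter, mem_dedup, List.mem_flatMap, List.mem_cons,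
      List.not_mem_nil, or_false] at h
    obtain ⟨⟨s', hs', rfl | rfl⟩, -⟩ := h <;> exact (size_cofactor_le _ _).trans (ih hs')

theorem mem_allStates {rows : State} {n : ℕ} {p : ℕ × State} :
    p ∈ allStates rows n ↔ p.1 < n ∧ p.2 ∈ level rows p.1 := by
  obtain ⟨i, s⟩ := p
  induction n with
  | zero => simp [allStates]
  | succ n ih =>
    simp only [allStates, List.mem_append, List.mem_map, Prod.mk.injEq, ih]
    constructor
    · rintro (⟨s', h, rfl, rfl⟩ | h)
      · exact ⟨Nat.lt_succ_self _, h⟩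
      · exact ⟨h.1.trans (Nat.lt_succ_self _), h.2⟩
    · rintro ⟨h, h'⟩
      rcases Nat.lt_succ_iff_lt_or_eq.1 h with h | rfl
      · exact .inr ⟨h, h'⟩
      · exact .inl ⟨s, h', rfl, rfl⟩

theorem size_allStates_le {rows : State} {n w : ℕ} (h : ∀ i < n, (level rows i).length ≤ w) :
    (enc (allStates rows n)).size ≤ n * w * (2 * n + (enc rows).size + 3) + 1 := by
  have h₁ : (allStates rows n).length ≤ n * w := by
    induction n with
    | zero => simp [allStates]
    | succ n ih =>
      have h₁ := ih fun i hi => h i (hi.trans n.lt_succ_self)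
      have h₂ := h n n.lt_succ_self
      simp only [allStates, List.length_append, List.length_map, add_mul, one_mul]
      omega
  refine (size_enc_list_le (B := 2 * n + (enc rows).size + 2) fun p hp => ?_).trans
    (Nat.add_le_add_right (Nat.mul_le_mul_right _ h₁) 1)
  obtain ⟨h₂, h₃⟩ := mem_allStates.1 hp
  have h₄ := size_le_of_mem_level h₃
  have h₅ : (enc p).size = (enc p.1).size + (enc p.2).size + 1 := rfl
  rw [size_enc_nat] at h₅
  omega

/-- The two recursions as a single loop that carries the index, the current level and the states
collected so far. -/
theorem forward_eq (rows : State) (n : ℕ) :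
    (List.replicate n ()).foldl (fun (acc : ℕ × List State × List (ℕ × State)) _ =>
      (acc.1 + 1, expand acc.2.1, acc.2.1.map (fun s => (acc.1, s)) ++ acc.2.2))
      (0, [norm rows].filter isInner, []) = (n, level rows n, allStates rows n) := by
  induction n with
  | zero => rfl
  | succ n ih => rw [List.replicate_succ', List.foldl_append, ih]; rfl

/-- The construction takes polynomial time as long as the levels have polynomial length. -/
theorem polyTime_buildDiagram {α : Type} [Enc α] {n : α → ℕ} {rows : α → State}
    (hn : PolyTime n) (hr : PolyTime rows) (p : Polynomial ℕ)
    (hp : ∀ a, ∀ i ≤ n a, (level (rows a) i).length ≤ p.eval (enc a).size) :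
    PolyTime (fun a => buildDiagram (n a) (rows a)) := by
  obtain ⟨q, hq⟩ := hr.exists_size_le
  obtain ⟨r, hr'⟩ := hn.exists_size_le
  have hlist : PolyTime (fun a => List.replicate (n a) ()) :=
    hn.congr_enc fun a => enc_replicate _
  have hfold := hlist.foldl (g := fun _ (acc : ℕ × List State × List (ℕ × State)) _ =>
      (acc.1 + 1, expand acc.2.1, acc.2.1.map (fun s => (acc.1, s)) ++ acc.2.2))
    (c := fun a => (0, [norm (rows a)].filter isInner, []))
    ((PolyTime.const 0).pair ((PolyTime.filter (g := fun _ s => isInner s)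
      (hr.norm.cons (PolyTime.const [])) (PolyTime.isInner PolyTime.id.snd)).pair
      (PolyTime.const [])))
    (PolyTime.id.snd.fst.fst.succ.pair (PolyTime.id.snd.fst.snd.fst.expand.pair
      ((PolyTime.map (g := fun a s => (a.2.1.1, s)) PolyTime.id.snd.fst.snd.fst
        (PolyTime.id.fst.snd.fst.fst.pair PolyTime.id.snd)).append PolyTime.id.snd.fst.snd.snd)))
    -- The summands bound the counter, the current level and the collected states; `2` counts the
    -- pairing nodes.
    (r + (p * (q + 1) + 1) + (r * p * (2 * r + q + 3) + 1) + 2) ?_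
  · have hall : PolyTime (fun a => allStates (rows a) (n a)) :=
      hfold.snd.snd.congr fun a => by rw [forward_eq]
    have htab : PolyTime (fun a => assignAll (allStates (rows a) (n a))) :=
      polyTime_assignAll.comp hall
    exact (htab.fst.refOf ((PolyTime.const 0).pair hr.norm)).pair
      (PolyTime.map (g := fun _ e => e.1) htab.snd.reverse PolyTime.id.snd.fst)
  · intro a l₁ l₂ h
    obtain ⟨m, rfl⟩ : ∃ m, l₁ = List.replicate m () := ⟨l₁.length, by
      rw [List.eq_replicate_iff]; simp⟩
    have hm : m ≤ n a := by
      have := congrArg List.length h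
      simp only [List.length_replicate, List.length_append] at this
      omega
    rw [forward_eq]
    have h₁ := hq a
    have h₂ := hr' a
    rw [size_enc_nat] at h₂
    have h₃ : (enc (level (rows a) m)).size ≤
        p.eval (enc a).size * (q.eval (enc a).size + 1) + 1 :=
      (size_enc_list_le fun s hs => (size_le_of_mem_level hs).trans h₁).trans
        (Nat.add_le_add_right (Nat.mul_le_mul_right _ (hp a m hm)) 1)
    have h₄ : (enc (allStates (rows a) m)).size ≤ r.eval (enc a).size * p.eval (enc a).size *
        (2 * r.eval (enc a).size + q.eval (enc a).size + 3) + 1 := by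
      refine (size_allStates_le fun i hi => hp a i (by omega)).trans ?_
      gcongr
      · omega
      · omega
    simp only [size_enc_prod, size_enc_nat, Polynomial.eval_add, Polynomial.eval_mul,
      Polynomial.eval_ofNat, Polynomial.eval_one]
    omega

/-! ## Decision diagrams without duplicate nodes -/

namespace Diagram

variable {n : ℕ}

/-- The layer of an inner node, and `n` for the leaves. -/
def rank (B : Diagram n) : Node B.s → ℕ
  | .inner i => B.layer i
  | _ => n

theorem rank_le (B : Diagram n) (u : Node B.s) : B.rank u ≤ n := by
  cases u with
  | inner i => exact (B.layer i).2.le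
  | _ => exact le_rfl

theorem Arc.rank_lt {B : Diagram n}
    (ho : ∀ i j b, B.child i b = Node.inner j → B.layer i < B.layer j) {b : Bool}
    {u v : Node B.s} (h : B.Arc b u v) : B.rank u < B.rank v := by
  obtain ⟨i, rfl, rfl⟩ := h
  rcases hc : B.child i b with _ | _ | j
  · exact (B.layer i).2
  · exact (B.layer i).2
  · exact ho i j b hc

theorem Reach.eq_or_rank_lt {B : Diagram n}
    (ho : ∀ i j b, B.child i b = Node.inner j → B.layer i < B.layer j)
    {u v : Node B.s} (h : B.Reach u v) : u = v ∨ B.rank u < B.rank v := by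
  induction h with
  | refl => exact .inl rfl
  | tail _ h ih =>
    obtain ⟨b, h⟩ := h
    have := h.rank_lt ho
    rcases ih with rfl | ih
    · exact .inr this
    · exact .inr (ih.trans this)

/-- An ordered diagram in which no two inner nodes have the same layer and the same children
has no isomorphic sub-diagrams. -/
theorem eq_of_subIso {B : Diagram n}
    (ho : ∀ i j b, B.child i b = Node.inner j → B.layer i < B.layer j)
    (hu : ∀ i j, B.layer i = B.layer j → (∀ b, B.child i b = B.child j b) → i = j)
    {u v : Node B.s} (h : B.SubIso u v) : u = v := by
  obtain ⟨φ, hl, ha⟩ := h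
  -- The isomorphism fixes every node, by induction from the leaves upwards: once the children of
  -- `w` are fixed, `φ w` has the same layer and the same children as `w`.
  have key : ∀ (m : ℕ) (w : {w // B.Reach u w}), n - B.rank w.1 = m → (φ w).1 = w.1 := by
    intro m
    induction m using Nat.strong_induction_on with
    | _ m ih =>
      rintro ⟨w, hw⟩ hm
      have hlw := hl ⟨w, hw⟩
      rcases w with _ | _ | i
      · cases hφ : (φ ⟨_, hw⟩).1 <;> simp_all [label]
      · cases hφ : (φ ⟨_, hw⟩).1 <;> simp_all [label]
      · obtain ⟨i', hi'⟩ : ∃ i', (φ ⟨_, hw⟩).1 = Node.inner i' := by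
          cases hφ : (φ ⟨_, hw⟩).1 <;> simp_all [label]
        rw [hi'] at hlw ⊢
        have hlayer : B.layer i' = B.layer i := by simpa [label] using hlw
        rw [hu i' i hlayer fun b => ?_]
        have harc : B.Arc b (Node.inner i) (B.child i b) := ⟨i, rfl, rfl⟩
        have hr : B.Reach u (B.child i b) := hw.tail ⟨b, harc⟩
        have h₁ := (ha b ⟨_, hw⟩ ⟨_, hr⟩).1 harc
        have h₂ := harc.rank_lt ho
        have h₃ := B.rank_le (B.child i b)
        have h₄ : n - B.rank (B.child i b) < n - B.rank (Node.inner i) := by omega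
        rw [ih _ (h₄.trans_eq hm) ⟨_, hr⟩ rfl, hi'] at h₁
        obtain ⟨i'', h₅, h₆⟩ := h₁
        cases h₅
        exact h₆
  -- As `φ` fixes `u` and `v`, each is reachable from the other; ranks increase along arcs, so they
  -- are equal.
  have h₁ : B.Reach v u := by
    have h := (φ ⟨u, .refl⟩).2
    rwa [key _ ⟨u, .refl⟩ rfl] at h
  obtain ⟨w, hw⟩ := φ.surjective ⟨v, .refl⟩
  have h₂ : B.Reach u v := by
    have h := w.2
    rwa [← key _ w rfl, hw] at h
  rcases h₁.eq_or_rank_lt ho with h₁ | h₁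
  · exact h₁.symm
  rcases h₂.eq_or_rank_lt ho with h₂ | h₂
  · exact h₂
  · omega

/-- Some path from `u` to `⊤` uses only arcs whose label agrees with `ξ`. -/
def SatFrom (B : Diagram n) (ξ : Finset (Fin n)) (u : Node B.s) : Prop :=
  Relation.ReflTransGen
    (fun u v => ∃ i, u = Node.inner i ∧ B.child i (decide (B.layer i ∈ ξ)) = v) u Node.top

theorem satFrom_top (B : Diagram n) (ξ : Finset (Fin n)) : B.SatFrom ξ .top := .refl

theorem not_satFrom_bot (B : Diagram n) (ξ : Finset (Fin n)) : ¬ B.SatFrom ξ .bot := by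
  intro h
  rcases h.cases_head with h | ⟨_, ⟨i, h, -⟩, -⟩ <;> cases h

theorem satFrom_inner (B : Diagram n) (ξ : Finset (Fin n)) (i : Fin B.s) :
    B.SatFrom ξ (.inner i) ↔ B.SatFrom ξ (B.child i (decide (B.layer i ∈ ξ))) := by
  constructor
  · intro h
    rcases h.cases_head with h | ⟨_, ⟨j, h, rfl⟩, h'⟩
    · cases h
    · cases h; exact h'
  · exact fun h => h.head ⟨i, rfl, rfl⟩

end Diagram

/-! ## Lists of clauses -/

/-- Every clause contains one of the variables with index `i + j` that are true. -/
def StateSat (x : ℕ → Bool) (i : ℕ) (s : State) : Prop :=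
  ∀ r ∈ s, ∃ j, r.getD j false = true ∧ x (i + j) = true

theorem any_id_iff (r : List Bool) : r.any id = true ↔ ∃ j, r.getD j false = true := by
  induction r with
  | nil => simp
  | cons b r ih =>
    rw [List.any_cons, Bool.or_eq_true, ih]
    constructor
    · rintro (h | ⟨j, h⟩)
      · exact ⟨0, h⟩
      · exact ⟨j + 1, h⟩
    · rintro ⟨_ | j, h⟩
      · exact .inl h
      · exact .inr ⟨j, h⟩

theorem stateSat_norm (x : ℕ → Bool) (i : ℕ) (s : State) :
    StateSat x i (norm s) ↔ StateSat x i s := by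
  rw [norm]
  split_ifs with h
  · obtain ⟨r, hr, h⟩ := List.any_eq_true.1 h
    refine iff_of_false (fun h' => ?_) fun h' => ?_
    · obtain ⟨j, hj, -⟩ := h' [] (by simp)
      simp at hj
    · obtain ⟨j, hj, -⟩ := h' r hr
      rw [(any_id_iff r).2 ⟨j, hj⟩] at h
      cases h
  · rfl

/-- A clause is either satisfied by its first variable, and then dropped, or its tail must be
satisfied by later ones. -/
theorem stateSat_cofactor (x : ℕ → Bool) (i : ℕ) (s : State) :
    StateSat x (i + 1) (cofactor (x i) s) ↔ StateSat x i s := by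
  have hrow : ∀ r : List Bool, (∃ j, r.getD j false = true ∧ x (i + j) = true) ↔
      ((x i && r.headD false) = true ∨ ∃ j, r.tail.getD j false = true ∧ x (i + 1 + j) = true) := by
    intro r
    cases r with
    | nil => simp
    | cons b r =>
      constructor
      · rintro ⟨_ | j, h, h'⟩
        · left
          simp only [List.getD_cons_zero, Nat.add_zero] at h h'
          simp [h, h']
        · exact .inr ⟨j, h, by rw [add_assoc, add_comm 1]; exact h'⟩
      · rintro (h | ⟨j, h, h'⟩)
        · rw [Bool.and_eq_true] at h
          exact ⟨0, h.2, h.1⟩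
        · exact ⟨j + 1, h, by rw [add_assoc, add_comm 1] at h'; exact h'⟩
  rw [cofactor, stateSat_norm]
  simp only [StateSat, List.mem_map, List.mem_filter]
  constructor
  · intro h r hr
    rw [hrow]
    by_cases hb : (x i && r.headD false) = true
    · exact .inl hb
    · exact .inr (h r.tail ⟨r, ⟨hr, by rw [Bool.not_eq_true] at hb; rw [hb]; rfl⟩, rfl⟩)
  · rintro h _ ⟨r, ⟨hr, hb⟩, rfl⟩
    rcases (hrow r).1 (h r hr) with h' | h'
    · rw [h'] at hb; cases hb
    · exact h'

theorem isInner_iff {s : State} : isInner s = true ↔ s ≠ [] ∧ s ≠ [[]] := by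
  simp [isInner]

/-- The replacement `[[]]` is not inner, so an inner result shows that nothing was replaced. -/
theorem norm_of_isInner {s : State} (h : isInner (norm s) = true) :
    norm s = s ∧ ∀ r ∈ s, r.any id = true := by
  rw [norm] at h ⊢
  split_ifs at h ⊢ with hs
  · simp [isInner] at h
  · refine ⟨rfl, fun r hr => ?_⟩
    by_contra h'
    exact hs (List.any_eq_true.2 ⟨r, hr, by simpa using h'⟩)

theorem mem_level_zero {rows s : State} :
    s ∈ level rows 0 ↔ isInner s = true ∧ s = norm rows := by
  simp only [level, List.mem_filter, List.mem_singleton]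
  tauto

theorem mem_level_succ {rows s : State} {i : ℕ} :
    s ∈ level rows (i + 1) ↔ isInner s = true ∧ ∃ s' ∈ level rows i, ∃ b, s = cofactor b s' := by
  simp only [level, expand, List.mem_filter, mem_dedup, List.mem_flatMap, List.mem_cons,
    List.not_mem_nil, or_false, Bool.exists_bool]
  exact and_comm

theorem nodup_level (rows : State) (i : ℕ) : (level rows i).Nodup := by
  cases i with
  | zero => exact (List.nodup_singleton _).filter _
  | succ i => exact (nodup_dedup _).filter _

theorem isInner_of_mem_level {rows s : State} {i : ℕ} (h : s ∈ level rows i) :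
    isInner s = true := by
  cases i with
  | zero => exact (mem_level_zero.1 h).1
  | succ i => exact (mem_level_succ.1 h).1

theorem exists_norm_of_mem_level {rows s : State} {i : ℕ} (h : s ∈ level rows i) :
    ∃ s', s = norm s' := by
  cases i with
  | zero => exact ⟨_, (mem_level_zero.1 h).2⟩
  | succ i =>
    obtain ⟨-, s', -, b, rfl⟩ := mem_level_succ.1 h
    exact ⟨_, rfl⟩

theorem any_of_mem_level {rows s : State} {i : ℕ} (h : s ∈ level rows i) {r : List Bool}
    (hr : r ∈ s) : r.any id = true := by
  have h₁ := isInner_of_mem_level h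
  obtain ⟨s', rfl⟩ := exists_norm_of_mem_level h
  obtain ⟨h₂, h₃⟩ := norm_of_isInner h₁
  exact h₃ r (h₂ ▸ hr)

theorem length_of_mem_level {rows s : State} {n i : ℕ} (hn : ∀ r ∈ rows, r.length = n)
    (h : s ∈ level rows i) {r : List Bool} (hr : r ∈ s) : r.length + i = n := by
  induction i generalizing s r with
  | zero =>
    obtain ⟨h₁, rfl⟩ := mem_level_zero.1 h
    rw [(norm_of_isInner h₁).1] at hr
    exact hn r hr
  | succ i ih =>
    obtain ⟨h₁, s', hs', b, rfl⟩ := mem_level_succ.1 h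
    rw [cofactor, (norm_of_isInner h₁).1] at hr
    simp only [List.mem_map, List.mem_filter] at hr
    obtain ⟨r', ⟨hr', -⟩, rfl⟩ := hr
    have h₂ := ih hs' hr'
    have h₃ := any_of_mem_level hs' hr'
    cases r' with
    | nil => simp at h₃
    | cons b r' => rw [List.tail_cons, ← h₂, List.length_cons]; omega

/-- An inner state contains a clause with a one, hence a clause of positive length `n - i`. -/
theorem lt_of_mem_level {rows s : State} {n i : ℕ} (hn : ∀ r ∈ rows, r.length = n)
    (h : s ∈ level rows i) : i < n := by
  have h₁ := isInner_iff.1 (isInner_of_mem_level h)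
  obtain ⟨r, hr⟩ := List.exists_mem_of_ne_nil s h₁.1
  have h₂ := length_of_mem_level hn h hr
  have h₃ := any_of_mem_level h hr
  cases r with
  | nil => simp at h₃
  | cons b r => rw [List.length_cons] at h₂; omega

/-! ## The tables of nodes -/

section Lookup

variable {α β : Type} [DecidableEq α]

theorem lookupD_cons (a : α) (d : β) (e : α × β) (l : List (α × β)) :
    lookupD a d (e :: l) = lookupD a (if e.1 = a then e.2 else d) l := rfl

theorem lookupD_of_not_mem {a : α} {d : β} {l : List (α × β)}
    (h : a ∉ l.map Prod.fst) : lookupD a d l = d := by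
  rcases lookupD_cases a d l with h' | h'
  · exact h'
  · exact absurd (List.mem_map_of_mem (f := Prod.fst) h') h

end Lookup

/-- The unique table belonging to a list of keys, the key of the last node first. -/
def nodeTable : List Key → List (Key × Ref)
  | [] => []
  | k :: K => (k, .inner K.length) :: nodeTable K

theorem map_fst_nodeTable (K : List Key) : (nodeTable K).map Prod.fst = K := by
  induction K with
  | nil => rfl
  | cons k K ih => rw [nodeTable, List.map_cons, ih]

theorem length_nodeTable (K : List Key) : (nodeTable K).length = K.length := by
  rw [← List.length_map (f := Prod.fst), map_fst_nodeTable]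

/-- Keys are stored newest first while nodes are numbered by age, so node `j` sits at position `j`
of `K.reverse`. -/
theorem lookupD_nodeTable {K : List Key} {k : Key} (h : k ∈ K) (d : Ref) :
    ∃ j, lookupD k d (nodeTable K) = .inner j ∧ K.reverse[j]? = some k := by
  induction K generalizing d with
  | nil => simp at h
  | cons k' K ih =>
    rw [nodeTable, lookupD_cons, List.reverse_cons]
    by_cases hk : k ∈ K
    · obtain ⟨j, h₁, h₂⟩ := ih hk (if (k', Ref.inner K.length).1 = k then
        (k', Ref.inner K.length).2 else d)
      refine ⟨j, h₁, ?_⟩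
      rw [List.getElem?_append_left]
      · exact h₂
      · exact (List.getElem?_eq_some_iff.1 h₂).1
    · rcases List.mem_cons.1 h with rfl | h
      · refine ⟨K.length, ?_, ?_⟩
        · rw [lookupD_of_not_mem (by rwa [map_fst_nodeTable]), if_pos rfl]
        · simp
      · exact absurd h hk

/-- The list of clauses is trivial or has an entry in the table. -/
def Closed (assoc : List ((ℕ × State) × Ref)) (p : ℕ × State) : Prop :=
  isInner p.2 = true → p ∈ assoc.map Prod.fst

/-- The tables describe a diagram. -/
structure TablesCorrect (n : ℕ) (assoc : List ((ℕ × State) × Ref)) (K : List Key) : Prop where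
  nodup : K.Nodup
  lt : ∀ p ∈ assoc.map Prod.fst, p.1 < n
  isInner : ∀ p ∈ assoc.map Prod.fst, isInner p.2 = true
  closed : ∀ p ∈ assoc.map Prod.fst, ∀ b, Closed assoc (p.1 + 1, cofactor b p.2)
  resolved : ∀ p ∈ assoc.map Prod.fst,
    (keyOf assoc p).2.1 = (keyOf assoc p).2.2 ∧ refOf assoc p = (keyOf assoc p).2.1 ∨
    (keyOf assoc p).2.1 ≠ (keyOf assoc p).2.2 ∧
      ∃ j, refOf assoc p = .inner j ∧ K.reverse[j]? = some (keyOf assoc p)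
  node : ∀ j k, K.reverse[j]? = some k →
    k.2.1 ≠ k.2.2 ∧ ∃ p ∈ assoc.map Prod.fst, refOf assoc p = .inner j ∧ k = keyOf assoc p
  layer : ∀ p j, refOf assoc p = .inner j → ∃ k, K.reverse[j]? = some k ∧ p.1 ≤ k.1

theorem refOf_cons_of_ne {assoc : List ((ℕ × State) × Ref)} {p q : ℕ × State} {r : Ref}
    (h : p ≠ q) : refOf ((p, r) :: assoc) q = refOf assoc q := by
  rw [refOf, lookupD_cons, if_neg h, refOf]

theorem refOf_cons_self {assoc : List ((ℕ × State) × Ref)} {p : ℕ × State} {r : Ref}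
    (h : p ∉ assoc.map Prod.fst) : refOf ((p, r) :: assoc) p = r := by
  rw [refOf, lookupD_cons, if_pos rfl, lookupD_of_not_mem h]

/-- The cofactors of `q` are trivial or already listed, whereas `p` is neither. A new entry for `p`
therefore cannot affect the children of `q`. -/
theorem keyOf_cons {assoc : List ((ℕ × State) × Ref)} {p q : ℕ × State} {r : Ref}
    (hp : isInner p.2 = true) (h : p ∉ assoc.map Prod.fst)
    (hq : ∀ b, Closed assoc (q.1 + 1, cofactor b q.2)) :
    keyOf ((p, r) :: assoc) q = keyOf assoc q := by
  have : ∀ b, p ≠ (q.1 + 1, cofactor b q.2) := by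
    rintro b rfl
    exact h (hq b hp)
  rw [keyOf, keyOf, refOf_cons_of_ne (this false), refOf_cons_of_ne (this true)]

theorem Closed.cons {assoc : List ((ℕ × State) × Ref)} {q : ℕ × State} (h : Closed assoc q)
    (e : (ℕ × State) × Ref) : Closed (e :: assoc) q :=
  fun hq => List.mem_cons_of_mem _ (h hq)

/-- The three outcomes of the reduction step: equal children are passed through, a known key is
shared, and a new key gets the next free number `K.length`. -/
theorem TablesCorrect.findRef_cases {n : ℕ} {assoc : List ((ℕ × State) × Ref)} {K : List Key}
    (h : TablesCorrect n assoc K) (p : ℕ × State) :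
    ∃ K', assign (assoc, nodeTable K) p =
        ((p, findRef (nodeTable K) (keyOf assoc p)) :: assoc, nodeTable K') ∧
      K'.Nodup ∧ K.reverse <+: K'.reverse ∧
      ((keyOf assoc p).2.1 = (keyOf assoc p).2.2 ∧
          findRef (nodeTable K) (keyOf assoc p) = (keyOf assoc p).2.1 ∨
        (keyOf assoc p).2.1 ≠ (keyOf assoc p).2.2 ∧
          ∃ j, findRef (nodeTable K) (keyOf assoc p) = .inner j ∧
            K'.reverse[j]? = some (keyOf assoc p)) ∧
      ∀ j k, K'.reverse[j]? = some k → K.reverse[j]? = some k ∨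
        findRef (nodeTable K) (keyOf assoc p) = .inner j ∧ k = keyOf assoc p ∧ k.2.1 ≠ k.2.2 := by
  set k := keyOf assoc p with hk
  have hlt : ∀ j k', K.reverse[j]? = some k' → j ≠ K.length := by
    intro j k' h'
    have := (List.getElem?_eq_some_iff.1 h').1
    rw [List.length_reverse] at this
    exact this.ne
  by_cases hlh : k.2.1 = k.2.2
  · have hr : findRef (nodeTable K) k = k.2.1 := if_pos hlh
    refine ⟨K, ?_, h.nodup, List.prefix_rfl, .inl ⟨hlh, hr⟩, fun j k h => .inl h⟩
    -- The common child is a leaf or an existing node, so it cannot be mistaken for the fresh number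
    -- `K.length`.
    rw [assign, ← hk, if_neg]
    rw [hr, length_nodeTable]
    intro h'
    obtain ⟨k', h₁, -⟩ := h.layer _ _ h'
    exact hlt _ _ h₁ rfl
  have hr : findRef (nodeTable K) k = lookupD k (.inner K.length) (nodeTable K) := by
    rw [findRef, if_neg hlh, length_nodeTable]
  by_cases hmem : k ∈ K
  · obtain ⟨j, hj, hj'⟩ := lookupD_nodeTable hmem (.inner K.length)
    refine ⟨K, ?_, h.nodup, List.prefix_rfl, .inr ⟨hlh, j, hr.trans hj, hj'⟩,
      fun j k h => .inl h⟩
    rw [assign, ← hk, if_neg]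
    rw [hr, length_nodeTable, hj, Ref.inner.injEq]
    exact hlt _ _ hj'
  · rw [lookupD_of_not_mem (by rwa [map_fst_nodeTable])] at hr
    refine ⟨k :: K, ?_, List.nodup_cons.2 ⟨hmem, h.nodup⟩, ?_,
      .inr ⟨hlh, K.length, hr, by simp⟩, fun j k' h' => ?_⟩
    · rw [assign, ← hk, if_pos (by rw [hr, length_nodeTable]), nodeTable, hr]
    · rw [List.reverse_cons]; exact List.prefix_append _ _
    · rw [List.reverse_cons] at h'
      rcases lt_or_ge j K.length with hj | hj
      · rw [List.getElem?_append_left (by rwa [List.length_reverse])] at h'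
        exact .inl h'
      · rw [List.getElem?_append_right (by rwa [List.length_reverse])] at h'
        have h₁ := (List.getElem?_eq_some_iff.1 h').1
        rw [List.length_reverse, List.length_singleton] at h₁
        obtain rfl : j = K.length := by omega
        simp only [List.length_reverse, Nat.sub_self, List.getElem?_cons_zero,
          Option.some.injEq] at h'
        exact .inr ⟨hr, h'.symm, h' ▸ hlh⟩

theorem TablesCorrect.assign {n : ℕ} {assoc : List ((ℕ × State) × Ref)} {K : List Key}
    (h : TablesCorrect n assoc K) {p : ℕ × State} (hlt : p.1 < n)
    (hp : ScenarioAgg.isInner p.2 = true) (hnew : p ∉ assoc.map Prod.fst)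
    (hcl : ∀ b, Closed assoc (p.1 + 1, cofactor b p.2)) :
    ∃ r K', ScenarioAgg.assign (assoc, nodeTable K) p = ((p, r) :: assoc, nodeTable K') ∧
      TablesCorrect n ((p, r) :: assoc) K' := by
  obtain ⟨K', h₁, h₂, h₃, h₄, h₅⟩ := h.findRef_cases p
  set r := findRef (nodeTable K) (keyOf assoc p)
  have hpre : ∀ {j : ℕ} {k : Key}, K.reverse[j]? = some k → K'.reverse[j]? = some k := by
    intro j k hj
    obtain ⟨l, hl⟩ := h₃
    rw [← hl, List.getElem?_append_left (List.getElem?_eq_some_iff.1 hj).1]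
    exact hj
  have hclosed : ∀ q ∈ ((p, r) :: assoc).map Prod.fst, ∀ b,
      Closed assoc (q.1 + 1, cofactor b q.2) := by
    intro q hq
    rcases List.mem_cons.1 hq with rfl | hq
    · exact hcl
    · exact h.closed q hq
  have hkey : ∀ q ∈ ((p, r) :: assoc).map Prod.fst,
      keyOf ((p, r) :: assoc) q = keyOf assoc q := fun q hq => keyOf_cons hp hnew (hclosed q hq)
  have hself : refOf ((p, r) :: assoc) p = r := refOf_cons_self hnew
  have hold : ∀ q ∈ assoc.map Prod.fst, refOf ((p, r) :: assoc) q = refOf assoc q :=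
    fun q hq => refOf_cons_of_ne fun h => hnew (h ▸ hq)
  refine ⟨r, K', h₁, h₂, ?_, ?_, fun q hq b => (hclosed q hq b).cons _, ?_, ?_, ?_⟩
  · intro q hq
    rcases List.mem_cons.1 hq with rfl | hq
    · exact hlt
    · exact h.lt q hq
  · intro q hq
    rcases List.mem_cons.1 hq with rfl | hq
    · exact hp
    · exact h.isInner q hq
  · intro q hq
    rw [hkey q hq]
    rcases List.mem_cons.1 hq with rfl | hq
    · rw [hself]; exact h₄
    · rw [hold q hq]
      rcases h.resolved q hq with h' | ⟨h', j, hj, hj'⟩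
      · exact .inl h'
      · exact .inr ⟨h', j, hj, hpre hj'⟩
  · intro j k hk
    rcases h₅ j k hk with hk | ⟨hj, rfl, hne⟩
    · obtain ⟨hne, q, hq, hq', rfl⟩ := h.node j k hk
      exact ⟨hne, q, List.mem_cons_of_mem _ hq, by rw [hold q hq, hq'],
        (hkey q (List.mem_cons_of_mem _ hq)).symm⟩
    · exact ⟨hne, p, List.mem_cons_self, by rw [hself, hj], (hkey p List.mem_cons_self).symm⟩
  · intro q j hq
    by_cases hqp : p = q
    · subst hqp
      rw [hself] at hq
      rcases h₄ with ⟨-, h'⟩ | ⟨-, j', hj, hj'⟩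
      · rw [h'] at hq
        obtain ⟨k, hk, hk'⟩ := h.layer _ _ hq
        exact ⟨k, hpre hk, (Nat.le_succ _).trans hk'⟩
      · rw [hq, Ref.inner.injEq] at hj
        exact ⟨_, hj ▸ hj', le_rfl⟩
    · rw [refOf_cons_of_ne hqp] at hq
      obtain ⟨k, hk, hk'⟩ := h.layer _ _ hq
      exact ⟨k, hpre hk, hk'⟩

theorem TablesCorrect.foldl {n : ℕ} {assoc : List ((ℕ × State) × Ref)} {K : List Key}
    (h : TablesCorrect n assoc K) (l : List (ℕ × State)) (hl : l.Nodup)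
    (hlt : ∀ p ∈ l, p.1 < n) (hp : ∀ p ∈ l, ScenarioAgg.isInner p.2 = true)
    (hnew : ∀ p ∈ l, p ∉ assoc.map Prod.fst)
    (hcl : ∀ p ∈ l, ∀ b, Closed assoc (p.1 + 1, cofactor b p.2)) :
    ∃ assoc' K', l.foldl ScenarioAgg.assign (assoc, nodeTable K) = (assoc', nodeTable K') ∧
      TablesCorrect n assoc' K' ∧
      ∀ p, p ∈ assoc'.map Prod.fst ↔ p ∈ l ∨ p ∈ assoc.map Prod.fst := by
  induction l generalizing assoc K with
  | nil => exact ⟨assoc, K, rfl, h, by simp⟩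
  | cons p l ih =>
    obtain ⟨r, K₁, h₁, h₂⟩ := h.assign (hlt p (by simp)) (hp p (by simp)) (hnew p (by simp))
      (hcl p (by simp))
    obtain ⟨hpl, hl⟩ := List.nodup_cons.1 hl
    obtain ⟨assoc', K', h₃, h₄, h₅⟩ := ih h₂ hl (fun q hq => hlt q (by simp [hq]))
      (fun q hq => hp q (by simp [hq]))
      (fun q hq hq' => by
        rcases List.mem_cons.1 hq' with rfl | hq'
        · exact hpl hq
        · exact hnew q (by simp [hq]) hq')
      (fun q hq b => (hcl q (by simp [hq]) b).cons _)
    refine ⟨assoc', K', by rw [List.foldl_cons, h₁, h₃], h₄, fun q => ?_⟩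
    rw [h₅, List.map_cons, List.mem_cons, List.mem_cons]
    tauto

theorem tablesCorrect_allStates {rows : State} {n : ℕ} (hn : ∀ r ∈ rows, r.length = n) :
    ∃ assoc K, assignAll (allStates rows n) = (assoc, nodeTable K) ∧ TablesCorrect n assoc K ∧
      ∀ p, p ∈ assoc.map Prod.fst ↔ p.2 ∈ level rows p.1 := by
  -- Invariant: exactly the states of the levels from `i` on have been entered. Going downwards in
  -- `i`, the cofactors of a state are always treated before it. The start `i = n` is the empty
  -- table, as levels from `n` on are empty.
  have key : ∀ i ≤ n, ∀ assoc K, TablesCorrect n assoc K →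
      (∀ p, p ∈ assoc.map Prod.fst ↔ i ≤ p.1 ∧ p.2 ∈ level rows p.1) →
      ∃ assoc' K', (allStates rows i).foldl assign (assoc, nodeTable K) = (assoc', nodeTable K') ∧
        TablesCorrect n assoc' K' ∧ ∀ p, p ∈ assoc'.map Prod.fst ↔ p.2 ∈ level rows p.1 := by
    intro i
    induction i with
    | zero => exact fun _ assoc K h h' => ⟨assoc, K, rfl, h, by simpa using h'⟩
    | succ i ih =>
      intro hi assoc K h h'
      obtain ⟨assoc₁, K₁, h₁, h₂, h₃⟩ := h.foldl ((level rows i).map fun s => (i, s))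
        ((nodup_level rows i).map (Prod.mk_right_injective i))
        (by simp only [List.mem_map]; rintro _ ⟨s, -, rfl⟩; exact hi)
        (by simp only [List.mem_map]; rintro _ ⟨s, hs, rfl⟩; exact isInner_of_mem_level hs)
        (by
          intro p hp hp'
          rw [h'] at hp'
          simp only [List.mem_map] at hp
          obtain ⟨s, -, rfl⟩ := hp
          have := hp'.1
          simp only at this
          omega)
        (by
          simp only [List.mem_map]
          rintro _ ⟨s, hs, rfl⟩ b hb
          exact (h' _).2 ⟨le_rfl, mem_level_succ.2 ⟨hb, s, hs, b, rfl⟩⟩)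
      rw [allStates, List.foldl_append, h₁]
      refine ih (by omega) assoc₁ K₁ h₂ fun p => ?_
      obtain ⟨j, s⟩ := p
      rw [h₃, h']
      simp only [List.mem_map, Prod.mk.injEq]
      constructor
      · rintro (⟨s', hs', rfl, rfl⟩ | ⟨h₄, h₅⟩)
        · exact ⟨le_rfl, hs'⟩
        · exact ⟨by omega, h₅⟩
      · rintro ⟨h₄, h₅⟩
        rcases h₄.eq_or_lt with rfl | h₄
        · exact .inl ⟨s, h₅, rfl, rfl⟩
        · exact .inr ⟨h₄, h₅⟩
  refine key n le_rfl [] [] ⟨List.nodup_nil, by simp, by simp, by simp, by simp, by simp, ?_⟩ ?_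
  · intro p j h
    rw [refOf] at h
    simp only [lookupD, List.foldl_nil] at h
    split_ifs at h
  · intro p
    simp only [List.map_nil, List.not_mem_nil, false_iff, not_and]
    intro h h'
    have := lt_of_mem_level hn h'
    omega

/-! ## The diagram described by the tables -/

/-- The value for numbers out of range is arbitrary; the references in correct tables are valid. -/
def Ref.toNode (s : ℕ) : Ref → Node s
  | .bot => .bot
  | .top => .top
  | .inner j => if h : j < s then .inner ⟨j, h⟩ else .bot

theorem Ref.toNode_inner {s j : ℕ} (h : j < s) : (Ref.inner j).toNode s = .inner ⟨j, h⟩ :=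
  dif_pos h

theorem Ref.Valid.encNode_toNode {s : ℕ} {r : Ref} (h : r.Valid s) :
    encNode (r.toNode s) = enc r := by
  cases r with
  | inner j => rw [Ref.toNode_inner h]; rfl
  | _ => rfl

theorem Ref.Valid.toNode_inj {s : ℕ} {r r' : Ref} (h : r.Valid s) (h' : r'.Valid s)
    (he : r.toNode s = r'.toNode s) : r = r' :=
  FaithfulEnc.inj (by rw [← h.encNode_toNode, he, h'.encNode_toNode])

/-- The diagram with root `root` and the given layers and children of the inner nodes. -/
def toDiagram (n : ℕ) (T : List Key) (hT : ∀ k ∈ T, k.1 < n) (root : Ref) : Diagram n where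
  s := T.length
  layer i := ⟨(T.get i).1, hT _ (T.get_mem i)⟩
  child i b := (bif b then (T.get i).2.2 else (T.get i).2.1).toNode T.length
  root := root.toNode T.length

theorem encList_ofFn {α : Type} [Enc α] (T : List α) :
    encList (List.ofFn fun i => enc (T.get i)) = enc T := by
  have : (List.ofFn fun i => enc (T.get i)) = T.map enc := by
    rw [← List.ofFn_get T, List.map_ofFn, List.ofFn_get]; rfl
  rw [this]; rfl

/-- `Ref` and `Key` are encoded just like nodes and their records, so the computed pair already is
the encoded diagram. -/
theorem encDiagram_toDiagram {n : ℕ} {T : List Key} (hT : ∀ k ∈ T, k.1 < n) {root : Ref}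
    (hroot : root.Valid T.length)
    (hval : ∀ k ∈ T, k.2.1.Valid T.length ∧ k.2.2.Valid T.length) :
    encDiagram (toDiagram n T hT root) = enc (root, T) := by
  rw [enc_prod, ← encList_ofFn, ← hroot.encNode_toNode, encDiagram]
  congr 2
  refine List.ofFn_inj.2 (funext fun i => ?_)
  have h := hval _ (T.get_mem i)
  exact congrArg₂ _ rfl (congrArg₂ _ h.1.encNode_toNode h.2.encNode_toNode)

section Diagram

variable {n : ℕ} {assoc : List ((ℕ × State) × Ref)} {K : List Key}

theorem TablesCorrect.refOf_valid (h : TablesCorrect n assoc K) (p : ℕ × State) :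
    (refOf assoc p).Valid K.reverse.length := by
  cases hr : refOf assoc p with
  | inner j =>
    obtain ⟨k, hk, -⟩ := h.layer p j hr
    exact (List.getElem?_eq_some_iff.1 hk).1
  | _ => trivial

theorem TablesCorrect.mem_reverse (h : TablesCorrect n assoc K) {k : Key}
    (hk : k ∈ K.reverse) : ∃ p ∈ assoc.map Prod.fst, k = keyOf assoc p := by
  obtain ⟨j, hj⟩ := List.mem_iff_getElem?.1 hk
  obtain ⟨-, p, hp, -, h'⟩ := h.node j k hj
  exact ⟨p, hp, h'⟩

theorem TablesCorrect.layer_lt (h : TablesCorrect n assoc K) :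
    ∀ k ∈ K.reverse, k.1 < n := by
  intro k hk
  obtain ⟨p, hp, rfl⟩ := h.mem_reverse hk
  exact h.lt p hp

theorem TablesCorrect.valid (h : TablesCorrect n assoc K) :
    ∀ k ∈ K.reverse, k.2.1.Valid K.reverse.length ∧ k.2.2.Valid K.reverse.length := by
  intro k hk
  obtain ⟨p, hp, rfl⟩ := h.mem_reverse hk
  exact ⟨h.refOf_valid _, h.refOf_valid _⟩

theorem bif_keyOf (p : ℕ × State) (b : Bool) :
    (bif b then (keyOf assoc p).2.2 else (keyOf assoc p).2.1) =
      refOf assoc (p.1 + 1, cofactor b p.2) := by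
  cases b <;> rfl

/-- Either the node of a list of clauses is also the node of its cofactors, or it is an inner
node with the nodes of the cofactors as children. -/
theorem TablesCorrect.node_cases (h : TablesCorrect n assoc K) {p : ℕ × State}
    (hp : p ∈ assoc.map Prod.fst) (root : Ref) :
    (∀ b, refOf assoc p = refOf assoc (p.1 + 1, cofactor b p.2)) ∨
    ∃ i : Fin (toDiagram n K.reverse h.layer_lt root).s,
      (refOf assoc p).toNode _ = .inner i ∧
      ((toDiagram n K.reverse h.layer_lt root).layer i : ℕ) = p.1 ∧
      ∀ b, (toDiagram n K.reverse h.layer_lt root).child i b =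
        (refOf assoc (p.1 + 1, cofactor b p.2)).toNode _ := by
  rcases h.resolved p hp with ⟨h₁, h₂⟩ | ⟨-, j, h₂, h₃⟩
  · refine .inl fun b => ?_
    rw [← bif_keyOf]
    cases b
    · exact h₂
    · exact h₂.trans h₁
  · obtain ⟨hj, hk⟩ := List.getElem?_eq_some_iff.1 h₃
    refine .inr ⟨⟨j, hj⟩, ?_, ?_, fun b => ?_⟩
    · rw [h₂]; exact Ref.toNode_inner hj
    · exact congrArg Prod.fst hk
    · rw [← bif_keyOf, ← hk]; rfl

/-- Ordering comes from the field `layer`, distinct children from `node`, and reducedness from the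
absence of repeated keys. The assumption `hreach` serves to reach every node from the root. -/
theorem TablesCorrect.isBDD (h : TablesCorrect n assoc K) (s : State)
    (hreach : ∀ p ∈ assoc.map Prod.fst, p = (0, s) ∨
      ∃ q ∈ assoc.map Prod.fst, ∃ b, p = (q.1 + 1, cofactor b q.2)) :
    (toDiagram n K.reverse h.layer_lt (refOf assoc (0, s))).IsBDD := by
  set B := toDiagram n K.reverse h.layer_lt (refOf assoc (0, s)) with hB
  have hnode : ∀ i : Fin B.s, (K.reverse.get i).2.1 ≠ (K.reverse.get i).2.2 ∧
      ∃ p ∈ assoc.map Prod.fst, refOf assoc p = .inner i ∧ K.reverse.get i = keyOf assoc p :=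
    fun i => h.node i _ (List.getElem?_eq_getElem i.2)
  have hchild : ∀ i b j, B.child i b = Node.inner j → ∃ r : Ref,
      (bif b then (K.reverse.get i).2.2 else (K.reverse.get i).2.1) = r ∧ r = .inner j := by
    intro i b j hc
    refine ⟨_, rfl, Ref.Valid.toNode_inj (s := B.s) ?_ j.2 (hc.trans (Ref.toNode_inner j.2).symm)⟩
    have := h.valid _ (K.reverse.get_mem i)
    cases b
    · exact this.1
    · exact this.2
  have ho : ∀ i j b, B.child i b = Node.inner j → B.layer i < B.layer j := by
    intro i j b hc
    obtain ⟨r, hr, rfl⟩ := hchild i b j hc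
    obtain ⟨-, p, hp, -, hp'⟩ := hnode i
    rw [hp', bif_keyOf] at hr
    obtain ⟨k, hk, hk'⟩ := h.layer _ _ hr
    have h₁ : (B.layer i : ℕ) = p.1 := congrArg Prod.fst hp'
    have h₂ : (B.layer j : ℕ) = k.1 :=
      congrArg Prod.fst (List.getElem?_eq_some_iff.1 hk).2
    have h₃ : p.1 + 1 ≤ k.1 := hk'
    rw [Fin.lt_def]
    omega
  refine ⟨ho, ?_, ?_, fun u v => Diagram.eq_of_subIso ho ?_⟩
  · intro i hi
    have := h.valid _ (K.reverse.get_mem i)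
    exact (hnode i).1 (Ref.Valid.toNode_inj this.1 this.2 hi)
  -- Induction on the level: from a state to its cofactor the reference either stays the same or
  -- follows an arc.
  · have key : ∀ m p, p ∈ assoc.map Prod.fst → p.1 = m →
        B.Reach B.root ((refOf assoc p).toNode _) := by
      intro m
      induction m with
      | zero =>
        intro p hp hm
        rcases hreach p hp with rfl | ⟨q, -, b, rfl⟩
        · exact .refl
        · simp at hm
      | succ m ih =>
        intro p hp hm
        rcases hreach p hp with rfl | ⟨q, hq, b, rfl⟩
        · exact .refl
        · have h₁ := ih q hq (by simpa using hm)
          rcases h.node_cases hq (refOf assoc (0, s)) with h₂ | ⟨i, h₂, -, h₃⟩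
          · rw [← h₂ b]; exact h₁
          · exact h₁.tail ⟨b, i, h₂, h₃ b⟩
    intro i
    obtain ⟨-, p, hp, hp', -⟩ := hnode i
    have := key _ p hp rfl
    rw [hp'] at this
    rwa [← Ref.toNode_inner i.2]
  · intro i j hl hc
    have h₁ := h.valid _ (K.reverse.get_mem i)
    have h₂ := h.valid _ (K.reverse.get_mem j)
    have h₃ : K.reverse.get i = K.reverse.get j :=
      Prod.ext (congrArg Fin.val hl) (Prod.ext
        (Ref.Valid.toNode_inj h₁.1 h₂.1 (hc false)) (Ref.Valid.toNode_inj h₁.2 h₂.2 (hc true)))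
    exact (List.nodup_reverse.2 h.nodup).injective_get h₃

/-- Induction on the number of undecided variables: the diagram and the clauses both pass to the
cofactor at `x p.1`, also where no node was created. -/
theorem TablesCorrect.satFrom_iff (h : TablesCorrect n assoc K) (root : Ref)
    (ξ : Finset (Fin n)) (x : ℕ → Bool) (hx : ∀ e : Fin n, x e = decide (e ∈ ξ))
    {p : ℕ × State} (hp : Closed assoc p) :
    (toDiagram n K.reverse h.layer_lt root).SatFrom ξ ((refOf assoc p).toNode _) ↔
      StateSat x p.1 p.2 := by
  set B := toDiagram n K.reverse h.layer_lt root with hB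
  generalize hm : n - p.1 = m
  induction m using Nat.strong_induction_on generalizing p with
  | _ m ih =>
    by_cases hpk : p ∈ assoc.map Prod.fst
    · have h₁ := h.lt p hpk
      have h₂ := ih (n - (p.1 + 1)) (by omega) (h.closed p hpk (x p.1)) rfl
      rw [stateSat_cofactor] at h₂
      refine Iff.trans ?_ h₂
      rcases h.node_cases hpk root with h₃ | ⟨i, h₃, h₄, h₅⟩
      · rw [h₃ (x p.1)]
      · rw [h₃, Diagram.satFrom_inner, h₅, ← hx, h₄]
    · have h₁ : ScenarioAgg.isInner p.2 = false := by
        by_contra h'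
        exact hpk (hp (by simpa using h'))
      -- Only the trivial lists `[]` and `[[]]` are missing from the table, and the default values
      -- are the correct leaves for them.
      have h₂ : refOf assoc p = if p.2 = [] then Ref.top else Ref.bot := lookupD_of_not_mem hpk
      rw [h₂]
      by_cases hp₀ : p.2 = []
      · rw [if_pos hp₀, hp₀]
        exact iff_of_true (B.satFrom_top ξ) (by simp [StateSat])
      · have hp₁ : p.2 = [[]] := by
          by_contra hp₁
          rw [isInner_iff.2 ⟨hp₀, hp₁⟩] at h₁
          cases h₁
        rw [if_neg hp₀, hp₁]
        exact iff_of_false (B.not_satFrom_bot ξ) (by simp [StateSat])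

end Diagram

/-- The constructed diagram is a reduced ordered decision diagram of the conjunction of the
clauses. -/
theorem exists_isBDD_buildDiagram {n : ℕ} {rows : State} (hn : ∀ r ∈ rows, r.length = n) :
    ∃ B : Diagram n, enc (buildDiagram n rows) = encDiagram B ∧ B.IsBDD ∧
      ∀ (ξ : Finset (Fin n)) (x : ℕ → Bool), (∀ e : Fin n, x e = decide (e ∈ ξ)) →
        (B.Sat ξ ↔ StateSat x 0 rows) := by
  obtain ⟨assoc, K, h₁, h₂, h₃⟩ := tablesCorrect_allStates hn
  refine ⟨toDiagram n K.reverse h₂.layer_lt (refOf assoc (0, norm rows)), ?_,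
    h₂.isBDD _ fun p hp => ?_, fun ξ x hx => ?_⟩
  · rw [encDiagram_toDiagram h₂.layer_lt (h₂.refOf_valid _) h₂.valid, buildDiagram, h₁,
      List.map_reverse, map_fst_nodeTable]
  · rw [h₃] at hp
    obtain ⟨i, s⟩ := p
    cases i with
    | zero => exact .inl (Prod.ext rfl (mem_level_zero.1 hp).2)
    | succ i =>
      obtain ⟨-, s', hs', b, rfl⟩ := mem_level_succ.1 hp
      exact .inr ⟨(i, s'), (h₃ _).2 hs', b, rfl⟩
  · refine (h₂.satFrom_iff (refOf assoc (0, norm rows)) ξ x hx (p := (0, norm rows))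
      fun h => ?_).trans (stateSat_norm x 0 rows)
    exact (h₃ _).2 (mem_level_zero.2 ⟨h, rfl⟩)

/-! ## Clauses of small bandwidth -/

/-- The list of clauses that remains after the first `i` variables have got the values `x`. -/
def run (rows : State) (x : ℕ → Bool) : ℕ → State
  | 0 => norm rows
  | i + 1 => cofactor (x i) (run rows x i)

theorem run_congr (rows : State) {x y : ℕ → Bool} {i : ℕ} (h : ∀ j < i, x j = y j) :
    run rows x i = run rows y i := by
  induction i with
  | zero => rfl
  | succ i ih =>
    rw [run, run, ih fun j hj => h j (hj.trans i.lt_succ_self), h i i.lt_succ_self]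

theorem exists_run_of_mem_level {rows s : State} {i : ℕ} (h : s ∈ level rows i) :
    ∃ x, s = run rows x i := by
  induction i generalizing s with
  | zero => exact ⟨fun _ => false, (mem_level_zero.1 h).2⟩
  | succ i ih =>
    obtain ⟨-, s', hs', b, rfl⟩ := mem_level_succ.1 h
    obtain ⟨x, rfl⟩ := ih hs'
    refine ⟨Function.update x i b, ?_⟩
    rw [run, Function.update_self]
    congr 1
    exact run_congr rows fun j hj => (Function.update_of_ne hj.ne _ _).symm

/-- One of the first `i` variables is true and contained in the clause. -/
def hit (x : ℕ → Bool) (i : ℕ) (r : List Bool) : Bool :=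
  (List.range i).any fun j => r.getD j false && x j

theorem hit_eq_true_iff {x : ℕ → Bool} {i : ℕ} {r : List Bool} :
    hit x i r = true ↔ ∃ j < i, r.getD j false = true ∧ x j = true := by
  simp [hit]

theorem isInner_of_isInner_cofactor {b : Bool} {s : State}
    (h : isInner (cofactor b s) = true) : isInner s = true := by
  rw [isInner_iff]
  constructor
  · rintro rfl
    exact absurd h (by cases b <;> decide)
  · rintro rfl
    exact absurd h (by cases b <;> decide)

/-- Trivial lists have trivial cofactors. An inner state has thus never been normalized away, and it
is literally the list of unhit rows, each with a one still to come. -/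
theorem run_eq_of_isInner {rows : State} {x : ℕ → Bool} {i : ℕ}
    (h : isInner (run rows x i) = true) :
    run rows x i = (rows.filter fun r => !hit x i r).map (List.drop i) ∧
      ∀ r ∈ rows, hit x i r = false → (r.drop i).any id = true := by
  induction i with
  | zero =>
    obtain ⟨h₁, h₂⟩ := norm_of_isInner h
    refine ⟨?_, fun r hr _ => h₂ r hr⟩
    rw [run, h₁, List.filter_eq_self.2 fun _ _ => by simp [hit]]
    exact (List.map_id rows).symm
  | succ i ih =>
    have h₀ := (ih (isInner_of_isInner_cofactor h)).1
    have h₁ : ((run rows x i).filter fun r => !(x i && r.headD false)).map List.tail =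
        (rows.filter fun r => !hit x (i + 1) r).map (List.drop (i + 1)) := by
      rw [h₀]
      clear h h₀ ih
      have hd : ∀ r : List Bool, (r.drop i).headD false = r.getD i false := by
        intro r
        rw [List.headD_eq_head?_getD, List.head?_drop, List.getD_eq_getElem?_getD]
      have hh : ∀ r, hit x (i + 1) r = (hit x i r || (r.getD i false && x i)) := by
        intro r; simp [hit, List.range_succ]
      induction rows with
      | nil => rfl
      | cons r rows ih =>
        rw [List.filter_cons, List.filter_cons, hh]
        cases h₁ : hit x i r
        · cases h₂ : r.getD i false && x i
          · have h₃ : (!(x i && (r.drop i).headD false)) = true := by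
              rw [hd, Bool.and_comm, h₂]; rfl
            rw [if_pos (show (!false) = true from rfl), if_pos (show (!(false || false)) = true from rfl),
              List.map_cons, List.filter_cons, if_pos h₃, List.map_cons, List.map_cons, ih, List.tail_drop]
          · have h₃ : (!(x i && (r.drop i).headD false)) = false := by
              rw [hd, Bool.and_comm, h₂]; rfl
            rw [if_pos (show (!false) = true from rfl), if_neg (by simp), List.map_cons, List.filter_cons,
              if_neg (by rw [h₃]; exact Bool.false_ne_true), ih]
        · rw [if_neg (by simp), if_neg (by simp), ih]
    rw [run, cofactor, h₁] at h
    obtain ⟨h₂, h₃⟩ := norm_of_isInner h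
    refine ⟨by rw [run, cofactor, h₁, h₂], fun r hr hr' => h₃ _ (List.mem_map_of_mem ?_)⟩
    rw [List.mem_filter]
    exact ⟨hr, by rw [hr']; rfl⟩

/-- The nonzero entries of each incidence vector lie in `k` consecutive columns. -/
def Banded (k : ℕ) (rows : State) : Prop :=
  ∀ r ∈ rows, ∀ j j', r.getD j false = true → r.getD j' false = true → j' < j + k

/-- A non-trivial list of clauses depends on the values of the last `k` variables only. -/
theorem run_eq_run {rows : State} {k i : ℕ} (hk : Banded k rows) {x y : ℕ → Bool}
    (hx : isInner (run rows x i) = true) (hy : isInner (run rows y i) = true)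
    (hxy : ∀ j < i, i - k ≤ j → x j = y j) : run rows x i = run rows y i := by
  -- A row unhit under `x` has a one at a column at least `i`. By the bandwidth its earlier ones lie
  -- at columns at least `i - k`, where `x` and `y` agree, so `y` does not hit it either.
  have key : ∀ x y : ℕ → Bool, isInner (run rows x i) = true →
      (∀ j < i, i - k ≤ j → x j = y j) → ∀ r ∈ rows, hit x i r = false → hit y i r = false := by
    intro x y hx hxy r hr hrx
    obtain ⟨j', hj'⟩ := (any_id_iff _).1 ((run_eq_of_isInner hx).2 r hr hrx)
    rw [List.getD_eq_getElem?_getD, List.getElem?_drop, ← List.getD_eq_getElem?_getD] at hj'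
    by_contra h
    rw [Bool.not_eq_false, hit_eq_true_iff] at h
    obtain ⟨j, hj, h₁, h₂⟩ := h
    have h₃ := hk r hr j _ h₁ hj'
    rw [← hxy j hj (by omega)] at h₂
    rw [hit_eq_true_iff.2 ⟨j, hj, h₁, h₂⟩] at hrx
    cases hrx
  rw [(run_eq_of_isInner hx).1, (run_eq_of_isInner hy).1]
  congr 1
  refine List.filter_congr fun r hr => ?_
  congr 1
  rw [Bool.eq_iff_iff, ← not_iff_not, Bool.not_eq_true, Bool.not_eq_true]
  exact ⟨key x y hx hxy r hr, key y x hy (fun j hj hj' => (hxy j hj hj').symm) r hr⟩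

theorem length_level_le {rows : State} {k : ℕ} (hk : Banded k rows) (i : ℕ) :
    (level rows i).length ≤ 2 ^ k := by
  have h : ∀ s, s ∈ level rows i → ∃ x, s = run rows x i := fun s => exists_run_of_mem_level
  choose! x hx using h
  have hcard : (Finset.univ : Finset (Fin k → Bool)).card = 2 ^ k := by simp
  rw [← List.toFinset_card_of_nodup (nodup_level rows i), ← hcard]
  -- A state is sent to its last `k` decisions. If `i < k` the window starts at `0` and also
  -- contains irrelevant later values.
  refine Finset.card_le_card_of_injOn (fun s t => x s (i - k + t)) (by simp) ?_
  intro s hs s' hs' h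
  rw [Finset.mem_coe, List.mem_toFinset] at hs hs'
  rw [hx s hs, hx s' hs']
  refine run_eq_run hk (hx s hs ▸ isInner_of_mem_level hs) (hx s' hs' ▸ isInner_of_mem_level hs')
    fun j hj hj' => ?_
  have := congrFun h ⟨j - (i - k), by omega⟩
  simpa only [Nat.add_sub_cancel' hj'] using this

/-! ## Explicitly given sets -/

/-- The incidence vectors of a list of sets. -/
def incidenceRows {n : ℕ} (R : List (Finset (Fin n))) : State :=
  R.map fun S => List.ofFn fun e => decide (e ∈ S)

theorem getD_ofFn_mem {n : ℕ} {S : Finset (Fin n)} {j : ℕ} :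
    (List.ofFn fun e => decide (e ∈ S)).getD j false = true ↔ ∃ h : j < n, ⟨j, h⟩ ∈ S := by
  rw [List.getD_eq_getElem?_getD, List.getElem?_ofFn]
  split_ifs with h <;> simp [h]

theorem banded_incidenceRows {n k : ℕ} {R : List (Finset (Fin n))}
    (h : BandwidthLE (incidence R) k) : Banded k (incidenceRows R) := by
  intro r hr j j' hj hj'
  obtain ⟨S, hS, rfl⟩ := List.mem_map.1 hr
  obtain ⟨hjn, hj⟩ := getD_ofFn_mem.1 hj
  obtain ⟨hjn', hj'⟩ := getD_ofFn_mem.1 hj'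
  obtain ⟨i, rfl⟩ := List.get_of_mem hS
  exact h i ⟨j, hjn⟩ ⟨j', hjn'⟩ (by simpa [incidence] using hj) (by simpa [incidence] using hj')

theorem enc_incidenceRows {n : ℕ} (R : List (Finset (Fin n))) :
    enc (incidenceRows R) = encList (R.map encSet) := by
  have : ∀ S : Finset (Fin n), enc (List.ofFn fun e => decide (e ∈ S)) = encSet S := by
    intro S
    rw [encSet]
    change encList (List.map enc _) = _
    rw [List.map_ofFn]; rfl
  change encList (List.map enc _) = _
  rw [incidenceRows, List.map_map]
  exact congrArg encList (List.map_congr_left fun S _ => this S)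

theorem stateSat_incidenceRows_iff {n : ℕ} {f : Finset (Fin n) → ℝ} {α : ℝ}
    {R : List (Finset (Fin n))} (hf : ∀ ξ₁ ξ₂, ξ₁ ⊆ ξ₂ → f ξ₂ ≤ f ξ₁) (hR : Lists f α R)
    {ξ : Finset (Fin n)} {x : ℕ → Bool} (hx : ∀ e : Fin n, x e = decide (e ∈ ξ)) :
    StateSat x 0 (incidenceRows R) ↔ f ξ ≤ α := by
  have h₁ : StateSat x 0 (incidenceRows R) ↔ ∀ S ∈ R, ¬ Disjoint S ξ := by
    simp only [StateSat, incidenceRows, List.forall_mem_map, getD_ofFn_mem,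
      Finset.not_disjoint_iff, Nat.zero_add]
    refine forall₂_congr fun S _ => ⟨?_, ?_⟩
    · rintro ⟨j, ⟨hj, hS⟩, h⟩
      exact ⟨⟨j, hj⟩, hS, by simpa using (hx ⟨j, hj⟩).symm.trans h⟩
    · rintro ⟨e, hS, h⟩
      exact ⟨e, ⟨e.2, hS⟩, by simpa [hx] using h⟩
  rw [h₁]
  constructor
  · intro h
    by_contra hα
    -- If `f ξ` exceeds `α`, then `ξᶜ` belongs to `TM f α`. A minimal member below it is listed and
    -- disjoint from `ξ`.
    obtain ⟨S, hS, hmin⟩ := exists_minimal_le_of_wellFoundedLT (fun T => T ∈ TM f α) ξᶜ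
      (by simpa [TM] using hα)
    exact h S (hR.2 S hmin) (Finset.subset_compl_iff_disjoint_right.1 hS)
  · intro h S hS hd
    have h₁ : α < f Sᶜ := hR.1 S hS
    have h₂ := hf ξ Sᶜ (Finset.subset_compl_iff_disjoint_left.2 hd)
    linarith

theorem exists_isLevelBDD {n : ℕ} {f : Finset (Fin n) → ℝ} {α : ℝ} {R : List (Finset (Fin n))}
    (hf : ∀ ξ₁ ξ₂, ξ₁ ⊆ ξ₂ → f ξ₂ ≤ f ξ₁) (hR : Lists f α R) :
    ∃ B : Diagram n, enc (buildDiagram n (incidenceRows R)) = encDiagram B ∧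
      B.IsLevelBDD f α := by
  obtain ⟨B, h₁, h₂, h₃⟩ := exists_isBDD_buildDiagram (n := n) (rows := incidenceRows R) (by
    intro r hr
    obtain ⟨S, -, rfl⟩ := List.mem_map.1 hr
    exact List.length_ofFn)
  refine ⟨B, h₁, h₂, fun ξ => ?_⟩
  obtain ⟨x, hx⟩ : ∃ x : ℕ → Bool, ∀ e : Fin n, x e = decide (e ∈ ξ) :=
    ⟨fun j => if h : j < n then decide (⟨j, h⟩ ∈ ξ) else false, fun e => by simp⟩
  rw [h₃ ξ x hx, stateSat_incidenceRows_iff hf hR hx]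

theorem exists_levelBDDs {n : ℕ} {f : Finset (Fin n) → ℝ}
    (hf : ∀ ξ₁ ξ₂, ξ₁ ⊆ ξ₂ → f ξ₂ ≤ f ξ₁) {as : List ℝ} {table : List (List (Finset (Fin n)))}
    (h : List.Forall₂ (Lists f) as table) :
    ∃ L : List (Diagram n),
      enc ((table.map incidenceRows).map (buildDiagram n)) = encList (L.map encDiagram) ∧
      List.Forall₂ (fun α B => B.IsLevelBDD f α) as L := by
  induction h with
  | nil => exact ⟨[], rfl, .nil⟩
  | cons h _ ih =>
    obtain ⟨B, h₁, h₂⟩ := exists_isLevelBDD hf h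
    obtain ⟨L, h₃, h₄⟩ := ih
    refine ⟨B :: L, ?_, .cons h₂ h₄⟩
    rw [List.map_cons, List.map_cons, enc_cons, h₁, h₃]; rfl

/-! ## Polynomial time -/

/-- Triples of further data, the number of elements and the tables of clauses, such that the
levels have length at most the value of `p` at the size of the triple. -/
abbrev TableInput (p : Polynomial ℕ) : Type :=
  {x : Data × ℕ × List State //
    ∀ rows ∈ x.2.2, ∀ i ≤ x.2.1, (level rows i).length ≤ p.eval (enc x).size}

theorem polyTime_map_buildDiagram (p : Polynomial ℕ) :
    PolyTime (fun x : TableInput p => x.1.2.2.map (buildDiagram x.1.2.1)) := by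
  have hx : PolyTime (fun x : TableInput p => x.1) := PolyTime.subtype_val
  refine PolyTime.map_of_mem (g := fun x => buildDiagram x.1.2.1) hx.snd.snd ?_
  have hy : PolyTime (fun y : {y : TableInput p × State // y.2 ∈ y.1.1.2.2} => y.1) :=
    PolyTime.subtype_val
  refine polyTime_buildDiagram (hx.comp hy.fst).snd.fst hy.snd p fun y i hi => ?_
  refine (y.1.1.2 y.1.2 y.2 i hi).trans (polynomial_eval_mono p ?_)
  -- The width bound survives since adding the current table to the argument only increases its
  -- size.
  change (enc y.1.1.1).size ≤ (enc y.1.1.1).size + (enc y.1.2).size + 1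
  omega

theorem exists_polynomial_two_pow_le {k : ℕ → ℕ}
    (hk : (fun σ => (k σ : ℝ)) =O[Filter.atTop] (fun σ : ℕ => Real.log σ)) :
    ∃ p : Polynomial ℕ, ∀ σ, 2 ^ k σ ≤ p.eval σ := by
  obtain ⟨c, hc⟩ := hk.bound
  obtain ⟨σ₀, h₀⟩ := Filter.eventually_atTop.1 hc
  -- For large `σ`, `2 ^ k σ ≤ exp (c * log σ) ≤ σ ^ ⌈c⌉₊`. The constant covers the finitely many `σ
  -- ≤ σ₀`, among them `σ = 0`.
  refine ⟨Polynomial.X ^ ⌈c⌉₊ + Polynomial.C (∑ j ∈ Finset.range (σ₀ + 1), 2 ^ k j), fun σ => ?_⟩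
  rw [Polynomial.eval_add, Polynomial.eval_pow, Polynomial.eval_X, Polynomial.eval_C]
  rcases lt_or_ge σ (σ₀ + 1) with hσ | hσ
  · exact le_add_left (Finset.single_le_sum (f := fun j => 2 ^ k j) (fun _ _ => Nat.zero_le _)
      (Finset.mem_range.2 hσ))
  · refine le_add_right ?_
    have hσ₁ : (1 : ℝ) ≤ σ := by exact_mod_cast (by omega : 1 ≤ σ)
    have hlog : 0 ≤ Real.log σ := Real.log_nonneg hσ₁
    have h₁ := h₀ σ (by omega)
    rw [Real.norm_of_nonneg (Nat.cast_nonneg _), Real.norm_of_nonneg hlog] at h₁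
    have h₂ : (k σ : ℝ) ≤ ⌈c⌉₊ * Real.log σ :=
      h₁.trans (mul_le_mul_of_nonneg_right (Nat.le_ceil c) hlog)
    have h₃ : (2 : ℝ) ^ k σ ≤ (σ : ℝ) ^ ⌈c⌉₊ := calc
      (2 : ℝ) ^ k σ ≤ Real.exp 1 ^ k σ := by
        gcongr
        have := Real.add_one_le_exp 1
        linarith
      _ = Real.exp (k σ) := by rw [← Real.exp_nat_mul, mul_one]
      _ ≤ Real.exp (⌈c⌉₊ * Real.log σ) := Real.exp_le_exp.2 h₂
      _ = (σ : ℝ) ^ ⌈c⌉₊ := by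
        rw [Real.exp_nat_mul, Real.exp_log (by linarith)]
    exact_mod_cast h₃

end ScenarioAgg

theorem mainTheorem1 (K : Set ScenarioAgg.Instance) (k : ℕ → ℕ)
    (hagg : ∀ I ∈ K, I.Aggregable)
    (hcrit : ScenarioAgg.PolynomiallyManyCriticalValues K)
    (hk : (fun σ => (k σ : ℝ)) =O[Filter.atTop] (fun σ : ℕ => Real.log σ))
    (hTM : ∀ I ∈ K, ∃ table : List (List (Finset (Fin I.n))), I.ExplicitTM table ∧
      ∀ R ∈ table, ScenarioAgg.BandwidthLE (ScenarioAgg.incidence R) (k I.inputSize)) :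
    ScenarioAgg.PolynomiallyAggregable K := by
  refine ⟨hagg, hcrit, ?_⟩
  obtain ⟨p, hp⟩ := ScenarioAgg.exists_polynomial_two_pow_le hk
  -- The program and its time bound depend only on `p`, hence are uniform over the class. An
  -- instance enters only as an argument that satisfies the width promise.
  obtain ⟨prog, q, hprog⟩ := ScenarioAgg.polyTime_map_buildDiagram p
  refine ⟨prog, q, fun I hI => ?_⟩
  obtain ⟨table, ⟨hlists, further, hinput⟩, hband⟩ := hTM I hI
  obtain ⟨L, hL, hbdd⟩ := ScenarioAgg.exists_levelBDDs
    (fun ξ₁ ξ₂ h => (hagg I hI).2.1 _ ξ₁ ξ₂ h) hlists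
  have henc : ScenarioAgg.Enc.enc (further, I.n, table.map ScenarioAgg.incidenceRows) =
      I.input := by
    rw [hinput]
    change ScenarioAgg.Data.node further (.node (ScenarioAgg.encNat I.n)
      (ScenarioAgg.encList (List.map ScenarioAgg.Enc.enc _))) = _
    rw [List.map_map]
    congr 3
    exact List.map_congr_left fun R _ => ScenarioAgg.enc_incidenceRows R
  have hlevel : ∀ rows ∈ table.map ScenarioAgg.incidenceRows, ∀ i ≤ I.n,
      (ScenarioAgg.level rows i).length ≤ p.eval
        (ScenarioAgg.Enc.enc (further, I.n, table.map ScenarioAgg.incidenceRows)).size := by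
    intro rows hrows i _
    obtain ⟨R, hR, rfl⟩ := List.mem_map.1 hrows
    rw [henc]
    exact (ScenarioAgg.length_level_le (ScenarioAgg.banded_incidenceRows (hband R hR)) i).trans
      (hp I.inputSize)
  obtain ⟨t, h₁, h₂⟩ := hprog ⟨(further, I.n, table.map ScenarioAgg.incidenceRows), hlevel⟩
  refine ⟨L, t, ?_, ?_, hbdd⟩
  · rw [← henc, ← hL]; exact h₁
  · rw [ScenarioAgg.Instance.inputSize, ← henc]; exact h₂
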